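/- Let $K$ be an algebraically closed field of characteristic zero. For a finite-dimensional Lie algebra $\mathfrak g$ over $K$ put $\operatorname{ind}\mathfrak g=\min_{f\in\mathfrak g^*}\dim\ker B_f$, where $B_f(x,y)=f([x,y])$; $\mathfrak g$ is called Frobenius if $\operatorname{ind}\mathfrak g=0$. For a positive integer $n$ let $\mathfrak{sp}(2n)$ be the Lie algebra of matrices $\begin{bmatrix}A&B\\ C&-\widehat A\end{bmatrix}$ with $A,B,C\in K^{n\times n}$, $B=\widehat B$, $C=\widehat C$, where $\widehat{\ }$ is the transpose with respect to the antidiagonal. It has the triangular decomposition $\mathfrak u_+\oplus\mathfrak h\oplus\mathfrak u_-$ into strictly upper triangular, diagonal and strictly lower triangular matrices, and simple roots $\alpha_1,\dots,\alpha_n$ in the standard order, $\alpha_n$ being the long root. For positive integers $a,b$ with $a+b\le n$ and $c\le n$ let $\mathfrak p_n^{C}((a,b)\mid(c))=\mathfrak p\cap\mathfrak p'$ be the seaweed subalgebra of $\mathfrak{sp}(2n)$ in which $\mathfrak p\supseteq\mathfrak h\oplus\mathfrak u_+$ is the parabolic subalgebra such that the simple roots $\alpha$ with $\mathfrak g_{-\alpha}\not\subseteq\mathfrak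 p$ are exactly $\alpha_a$ and $\alpha_{a+b}$, and $\mathfrak p'\supseteq\mathfrak h\oplus\mathfrak u_-$ is the parabolic subalgebra such that the only simple root $\alpha$ with $\mathfrak g_{\alpha}\not\subseteq\mathfrak p'$ is $\alpha_c$. (Equivalently, with $F_k$ the span of the first $k$ standard basis vectors and $F_k'$ the span of the last $2n-k$ ones, it consists of the matrices in $\mathfrak{sp}(2n)$ that map each of $F_a$, $F_{a+b}$ and $F'_c$ into itself.) Theorem. Let $a,b,c,n$ be positive integers with $a+b=n$ and $c\le n$. Then $\operatorname{ind}\mathfrak p_n^{C}((a,b)\mid(c))=0$, that is, $\mathfrak p_n^{C}((a,b)\mid(c))$ is Frobenius, if and only if one of the following conditions holds: (i) $c=n-1$ and $\gcd(a+b,b+c)=1$; (ii) $c=n-2$ and $\gcd(a+b,b+c)=1$; (iii) $c=n-3$, the integers $a$, $b$, $c$ are all odd, and $\gcd(a+b,b+c)=2$. -/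

import Mathlib

namespace SymplecticSeaweed

open LieAlgebra

attribute [local instance 100] LieRing.ofAssociativeRing

section Index

variable (K L : Type*) [Field K] [LieRing L] [LieAlgebra K L]

/-- The Kirillov form `B_f (x, y) = f ⁅x, y⁆` of a linear functional `f` on a Lie algebra. -/
def kirillovForm (f : Module.Dual K L) : LinearMap.BilinForm K L :=
  LinearMap.mk₂ K (fun x y => f ⁅x, y⁆)
    (fun x x' y => by rw [add_lie, map_add]) (fun t x y => by rw [smul_lie, map_smul])
    (fun x y y' => by rw [lie_add, map_add]) (fun t x y => by rw [lie_smul, map_smul])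

/-- The index of a finite-dimensional Lie algebra: the minimum over all linear functionals `f`
of the dimension of the kernel of `B_f` (an infimum of a nonempty set of natural numbers, so it is
attained). -/
noncomputable def index : ℕ :=
  ⨅ f : Module.Dual K L, Module.finrank K (LinearMap.ker (kirillovForm K L f))

end Index

section Seaweed

variable (K : Type*) [Field K] (n : ℕ)

/-- `𝔰𝔭(2n)` is Mathlib's `Symplectic.sp (Fin n) K`, the matrices `[A, B; C, -Aᵀ]` with `B` and `C`
symmetric, acting on `K ^ (2n)` with basis `e₁, …, eₙ, f₁, …, fₙ`. We order the basis as
`e₁ < ⋯ < eₙ < fₙ < ⋯ < f₁`; listing rows and columns in this order turns the matrices into those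
of the form `[A, B; C, -Â]` with `B = B̂`, `C = Ĉ`, where the hat is the transpose with respect to
the antidiagonal. `pos` is the (zero-based) position in this order. -/
def pos : Fin n ⊕ Fin n → ℕ
  | Sum.inl i => i
  | Sum.inr i => 2 * n - 1 - i

/-- Matrices that map the span of the first `k` basis vectors into itself. -/
def stabFirst (k : ℕ) : LieSubalgebra K (Matrix (Fin n ⊕ Fin n) (Fin n ⊕ Fin n) K) where
  carrier := {X | ∀ i j, pos n j < k → k ≤ pos n i → X i j = 0}
  add_mem' := fun hX hY i j hj hi => by
    rw [Matrix.add_apply, hX i j hj hi, hY i j hj hi, add_zero]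
  zero_mem' := fun _ _ _ _ => rfl
  smul_mem' := fun t X hX i j hj hi => by
    rw [Matrix.smul_apply, hX i j hj hi, smul_zero]
  lie_mem' := by
    intro X Y hX hY i j hj hi
    have key : ∀ X Y : Matrix (Fin n ⊕ Fin n) (Fin n ⊕ Fin n) K,
        (∀ i j, pos n j < k → k ≤ pos n i → X i j = 0) →
        (∀ i j, pos n j < k → k ≤ pos n i → Y i j = 0) → (X * Y) i j = 0 := by
      intro X Y hX hY
      rw [Matrix.mul_apply]
      refine Finset.sum_eq_zero fun l _ => ?_
      rcases lt_or_ge (pos n l) k with h | h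
      · rw [hX i l h hi, zero_mul]
      · rw [hY l j hj h, mul_zero]
    rw [LieRing.of_associative_ring_bracket, Matrix.sub_apply, key X Y hX hY, key Y X hY hX,
      sub_zero]

/-- Matrices that map the span of all but the first `k` basis vectors into itself. -/
def stabLast (k : ℕ) : LieSubalgebra K (Matrix (Fin n ⊕ Fin n) (Fin n ⊕ Fin n) K) where
  carrier := {X | ∀ i j, pos n i < k → k ≤ pos n j → X i j = 0}
  add_mem' := fun hX hY i j hi hj => by
    rw [Matrix.add_apply, hX i j hi hj, hY i j hi hj, add_zero]
  zero_mem' := fun _ _ _ _ => rfl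
  smul_mem' := fun t X hX i j hi hj => by
    rw [Matrix.smul_apply, hX i j hi hj, smul_zero]
  lie_mem' := by
    intro X Y hX hY i j hi hj
    have key : ∀ X Y : Matrix (Fin n ⊕ Fin n) (Fin n ⊕ Fin n) K,
        (∀ i j, pos n i < k → k ≤ pos n j → X i j = 0) →
        (∀ i j, pos n i < k → k ≤ pos n j → Y i j = 0) → (X * Y) i j = 0 := by
      intro X Y hX hY
      rw [Matrix.mul_apply]
      refine Finset.sum_eq_zero fun l _ => ?_
      rcases lt_or_ge (pos n l) k with h | h
      · rw [hY l j h hj, mul_zero]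
      · rw [hX i l hi h, zero_mul]
    rw [LieRing.of_associative_ring_bracket, Matrix.sub_apply, key X Y hX hY, key Y X hY hX,
      sub_zero]

/-- The standard parabolic subalgebra `𝔭 ⊇ 𝔥 ⊕ 𝔲₊` of `𝔰𝔭(2n)` attached to a set `Ψ` of simple
roots: the stabilizer of the isotropic flag made of the spans of the first `k` basis vectors,
`α_k ∈ Ψ`. A set of simple roots `α_1, …, α_n` is given by the set of its indices. The simple roots
`α` with `𝔤_{-α} ⊄ 𝔭` are exactly those in `Ψ`, see `negSimpleRootVector_mem_parabolic`. -/
def parabolic (Ψ : Set ℕ) : LieSubalgebra K (Matrix (Fin n ⊕ Fin n) (Fin n ⊕ Fin n) K) :=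
  Symplectic.sp (Fin n) K ⊓ ⨅ k ∈ Ψ, stabFirst K n k

/-- The standard parabolic subalgebra `𝔭' ⊇ 𝔥 ⊕ 𝔲₋` of `𝔰𝔭(2n)` attached to a set `Ψ'` of simple
roots, the simple roots `α` with `𝔤_α ⊄ 𝔭'`. -/
def oppParabolic (Ψ' : Set ℕ) : LieSubalgebra K (Matrix (Fin n ⊕ Fin n) (Fin n ⊕ Fin n) K) :=
  Symplectic.sp (Fin n) K ⊓ ⨅ k ∈ Ψ', stabLast K n k

/-- The indices of the simple roots attached to a string of positive integers `(a₁, …, a_m)` of sum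
at most `n`: the partial sums `a₁`, `a₁ + a₂`, …, `a₁ + ⋯ + a_m`. -/
def simpleRootsOf (a : List ℕ) : Set ℕ :=
  {k | ∃ m, 1 ≤ m ∧ m ≤ a.length ∧ k = (a.take m).sum}

/-- The seaweed subalgebra `𝔭ₙ^C(a | b)` of `𝔰𝔭(2n)`. -/
def seaweed (a b : List ℕ) : LieSubalgebra K (Matrix (Fin n ⊕ Fin n) (Fin n ⊕ Fin n) K) :=
  parabolic K n (simpleRootsOf a) ⊓ oppParabolic K n (simpleRootsOf b)

/-! Checks that the parabolic subalgebras are the intended ones. -/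

variable {K n}

theorem mem_sp_iff (X : Matrix (Fin n ⊕ Fin n) (Fin n ⊕ Fin n) K) :
    X ∈ Symplectic.sp (Fin n) K ↔
      X.toBlocks₂₂ = -X.toBlocks₁₁.transpose ∧ X.toBlocks₁₂.IsSymm ∧ X.toBlocks₂₁.IsSymm := by
  rw [Symplectic.sp, mem_skewAdjointMatricesLieSubalgebra, mem_skewAdjointMatricesSubmodule]
  obtain ⟨A, B, C, D, rfl⟩ : ∃ A B C D, X = Matrix.fromBlocks A B C D :=
    ⟨_, _, _, _, (Matrix.fromBlocks_toBlocks X).symm⟩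
  simp only [Matrix.IsSkewAdjoint, Matrix.IsAdjointPair, Matrix.J, Matrix.fromBlocks_transpose,
    Matrix.fromBlocks_multiply, Matrix.fromBlocks_neg, Matrix.fromBlocks_inj, Matrix.IsSymm,
    Matrix.toBlocks_fromBlocks₁₁, Matrix.toBlocks_fromBlocks₁₂, Matrix.toBlocks_fromBlocks₂₁,
    Matrix.toBlocks_fromBlocks₂₂, mul_zero, zero_mul, mul_one, one_mul, zero_add, add_zero,
    mul_neg, neg_mul, neg_zero, neg_neg]
  constructor
  · rintro ⟨h1, h2, h3, h4⟩
    exact ⟨h2.symm, neg_inj.mp h4, h1⟩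
  · rintro ⟨h1, h2, h3⟩
    refine ⟨h3, h1.symm, ?_, neg_inj.mpr h2⟩
    rw [h1, Matrix.transpose_neg, Matrix.transpose_transpose]

theorem mem_parabolic (Ψ : Set ℕ) (X : Matrix (Fin n ⊕ Fin n) (Fin n ⊕ Fin n) K) :
    X ∈ parabolic K n Ψ ↔ X ∈ Symplectic.sp (Fin n) K ∧
      ∀ k ∈ Ψ, ∀ i j, pos n j < k → k ≤ pos n i → X i j = 0 := by
  rw [parabolic, LieSubalgebra.mem_inf]
  refine and_congr_right fun _ => ?_
  rw [← SetLike.mem_coe, iInf, LieSubalgebra.coe_sInf]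
  simp only [Set.mem_range, Set.iInter_exists, Set.iInter_iInter_eq', iInf,
    LieSubalgebra.coe_sInf, Set.mem_iInter]
  rfl

theorem mem_oppParabolic (Ψ : Set ℕ) (X : Matrix (Fin n ⊕ Fin n) (Fin n ⊕ Fin n) K) :
    X ∈ oppParabolic K n Ψ ↔ X ∈ Symplectic.sp (Fin n) K ∧
      ∀ k ∈ Ψ, ∀ i j, pos n i < k → k ≤ pos n j → X i j = 0 := by
  rw [oppParabolic, LieSubalgebra.mem_inf]
  refine and_congr_right fun _ => ?_
  rw [← SetLike.mem_coe, iInf, LieSubalgebra.coe_sInf]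
  simp only [Set.mem_range, Set.iInter_exists, Set.iInter_iInter_eq', iInf,
    LieSubalgebra.coe_sInf, Set.mem_iInter]
  rfl

/-- Every matrix of `𝔰𝔭(2n)` that is upper triangular in the chosen order is in `parabolic`. -/
theorem upperTriangular_mem_parabolic (Ψ : Set ℕ)
    {X : Matrix (Fin n ⊕ Fin n) (Fin n ⊕ Fin n) K} (hX : X ∈ Symplectic.sp (Fin n) K)
    (hu : ∀ i j, pos n j < pos n i → X i j = 0) : X ∈ parabolic K n Ψ :=
  (mem_parabolic Ψ X).mpr ⟨hX, fun _ _ i j hj hi => hu i j (hj.trans_le hi)⟩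

/-- Every matrix of `𝔰𝔭(2n)` that is lower triangular in the chosen order is in `oppParabolic`. -/
theorem lowerTriangular_mem_oppParabolic (Ψ : Set ℕ)
    {X : Matrix (Fin n ⊕ Fin n) (Fin n ⊕ Fin n) K} (hX : X ∈ Symplectic.sp (Fin n) K)
    (hu : ∀ i j, pos n i < pos n j → X i j = 0) : X ∈ oppParabolic K n Ψ :=
  (mem_oppParabolic Ψ X).mpr ⟨hX, fun _ _ i j hj hi => hu i j (hj.trans_le hi)⟩

variable (K) in
/-- A generator of the root space of `-α_{k+1}`, `k < n`: it is `E_{e_{k+2}, e_{k+1}} -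
E_{f_{k+1}, f_{k+2}}` if `k + 1 < n` and `E_{f_n, e_n}` for the exceptional root `α_n`. Its
transpose generates the root space of `α_{k+1}`. -/
def negSimpleRootVector (k : Fin n) : Matrix (Fin n ⊕ Fin n) (Fin n ⊕ Fin n) K :=
  if h : (k : ℕ) + 1 < n then
    Matrix.single (Sum.inl ⟨k + 1, h⟩) (Sum.inl k) 1 -
      Matrix.single (Sum.inr k) (Sum.inr ⟨k + 1, h⟩) 1
  else Matrix.single (Sum.inr k) (Sum.inl k) 1

theorem negSimpleRootVector_mem_sp (k : Fin n) :
    negSimpleRootVector K k ∈ Symplectic.sp (Fin n) K := by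
  rw [mem_sp_iff]
  unfold negSimpleRootVector
  split_ifs with h
  · refine ⟨?_, ?_, ?_⟩ <;> ext i j <;>
      simp [Matrix.toBlocks₁₁, Matrix.toBlocks₁₂, Matrix.toBlocks₂₁, Matrix.toBlocks₂₂,
        Matrix.single_apply, and_comm]
  · refine ⟨?_, ?_, ?_⟩ <;> ext i j <;>
      simp [Matrix.toBlocks₁₁, Matrix.toBlocks₁₂, Matrix.toBlocks₂₁, Matrix.toBlocks₂₂,
        Matrix.single_apply, and_comm]

/-- `𝔤_{-α_{k+1}} ⊄ 𝔭` if and only if `α_{k+1} ∈ Ψ`. -/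
theorem negSimpleRootVector_mem_parabolic {Ψ : Set ℕ} (hΨ : Ψ ⊆ Set.Icc 1 n) (k : Fin n) :
    negSimpleRootVector K k ∈ parabolic K n Ψ ↔ (k : ℕ) + 1 ∉ Ψ := by
  have hk := k.isLt
  rw [mem_parabolic]
  constructor
  · rintro ⟨-, h⟩ hmem
    by_cases h1 : (k : ℕ) + 1 < n
    · have := h _ hmem (Sum.inl ⟨k + 1, h1⟩) (Sum.inl k) (by simp [pos]) (by simp [pos])
      simp [negSimpleRootVector, h1] at this
    · have := h _ hmem (Sum.inr k) (Sum.inl k) (by simp [pos]) (by simp only [pos]; omega)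
      simp [negSimpleRootVector, h1] at this
  · refine fun hk' => ⟨negSimpleRootVector_mem_sp k, fun m hm i j hj hi => ?_⟩
    have hmn := hΨ hm
    have hne : m ≠ k + 1 := fun h => hk' (h ▸ hm)
    simp only [Set.mem_Icc] at hmn
    unfold negSimpleRootVector
    split_ifs with h1
    · rw [Matrix.sub_apply, Matrix.single_apply_of_ne, Matrix.single_apply_of_ne, sub_zero]
      · rintro ⟨rfl, rfl⟩
        simp only [pos] at hi hj
        omega
      · rintro ⟨rfl, rfl⟩
        simp only [pos] at hi hj
        omega
    · rw [Matrix.single_apply_of_ne]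
      rintro ⟨rfl, rfl⟩
      simp only [pos] at hi hj
      omega

/-- `𝔤_{α_{k+1}} ⊄ 𝔭'` if and only if `α_{k+1} ∈ Ψ'`. -/
theorem simpleRootVector_mem_oppParabolic {Ψ : Set ℕ} (hΨ : Ψ ⊆ Set.Icc 1 n) (k : Fin n) :
    (negSimpleRootVector K k).transpose ∈ oppParabolic K n Ψ ↔ (k : ℕ) + 1 ∉ Ψ := by
  rw [← negSimpleRootVector_mem_parabolic (K := K) hΨ k, mem_parabolic, mem_oppParabolic]
  refine and_congr ?_ ?_
  · rw [iff_true_right (negSimpleRootVector_mem_sp k)]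
    have h := (mem_sp_iff _).mp (negSimpleRootVector_mem_sp (K := K) k)
    rw [mem_sp_iff]
    refine ⟨?_, ?_, ?_⟩
    · exact congrArg Matrix.transpose h.1
    · exact congrArg Matrix.transpose h.2.2
    · exact congrArg Matrix.transpose h.2.1
  · exact ⟨fun h m hm i j hj hi => h m hm j i hj hi, fun h m hm i j hi hj => h m hm j i hi hj⟩

end Seaweed

end SymplecticSeaweed

/-!
If a Lie algebra is the semidirect product of a subalgebra `L` and an abelian ideal `M`, then by a
criterion of Raïs it is Frobenius if and only if some functional on `M` has an open orbit under `L`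
and a stabilizer in `L` that is Frobenius.

Let `U` be the span of the first `a` and `W` that of the last `r = n - c` basis vectors of `Kⁿ`.
When `a + b = n`, the seaweed is the semidirect product of the stabilizer of `U` and `W` in `𝔤𝔩(n)`
and the symmetric square of `W`. A functional on the latter is a symmetric form on `W`; its orbit is
open if and only if the form is nondegenerate on `W` and on `U ∩ W`. If `W = 0`, then its stabilizer
has the identity in its center. Otherwise the stabilizer, which acts on `W` through `𝔰𝔬(W)`, is
again such a semidirect product, the abelian ideal being a space of off-diagonal blocks. Functionals
on it are linear maps, and those with an open orbit have maximal rank and a kernel in general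
position to `W` and the form. Applying the criterion repeatedly thus runs the Euclidean algorithm on
`(n, b - r)` until only algebras `𝔰𝔬(k)` remain. As the trace form of `𝔰𝔬(k)` is nondegenerate, it
is Frobenius only if it vanishes, that is, if `k ≤ 1`. This forces `r ≤ 3`, and
`gcd (n, b - r) = gcd (a + b, b + c)` turns the result into the conditions of the theorem.
-/

namespace SymplecticSeaweed

attribute [local instance 100] LieRing.ofAssociativeRing

section Frobenius

variable (K : Type*) [Field K]

/-- A Lie algebra is Frobenius if the Kirillov form of some linear functional is nondegenerate.
For finite-dimensional Lie algebras this means that the index is zero, see `index_eq_zero_iff`. -/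
def IsFrobenius (L : Type*) [LieRing L] [LieAlgebra K L] : Prop :=
  ∃ f : Module.Dual K L, (kirillovForm K L f).SeparatingLeft

variable {K} {L L' : Type*} [LieRing L] [LieAlgebra K L] [LieRing L'] [LieAlgebra K L']

theorem index_eq_zero_iff [FiniteDimensional K L] : index K L = 0 ↔ IsFrobenius K L := by
  have hempty : Set.range (fun f : Module.Dual K L =>
      Module.finrank K (LinearMap.ker (kirillovForm K L f))) ≠ ∅ :=
    (Set.range_nonempty _).ne_empty
  simp only [index, iInf, Nat.sInf_eq_zero, or_iff_left hempty, Set.mem_range,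
    Submodule.finrank_eq_zero, ← LinearMap.separatingLeft_iff_ker_eq_bot, IsFrobenius]

theorem IsFrobenius.of_equiv (e : L ≃ₗ⁅K⁆ L') : IsFrobenius K L → IsFrobenius K L' := by
  rintro ⟨f, hf⟩
  refine ⟨f ∘ₗ (e.symm : L' →ₗ[K] L), fun x hx => e.symm.injective ?_⟩
  rw [map_zero]
  refine hf _ fun y => ?_
  have := hx (e y)
  change f (e.symm ⁅x, e y⁆) = 0 at this
  rwa [LieEquiv.map_lie, e.symm_apply_apply] at this

theorem isFrobenius_congr (e : L ≃ₗ⁅K⁆ L') : IsFrobenius K L ↔ IsFrobenius K L' :=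
  ⟨.of_equiv e, .of_equiv e.symm⟩

theorem isFrobenius_range_iff {φ : L →ₗ⁅K⁆ L'} (hφ : Function.Injective φ) :
    IsFrobenius K φ.range ↔ IsFrobenius K L :=
  (isFrobenius_congr (φ.equivRangeOfInjective hφ)).symm

theorem isFrobenius_coe_iff {S : LieSubalgebra K L} :
    IsFrobenius K S ↔
      ∃ f : Module.Dual K L, ∀ x ∈ S, (∀ y ∈ S, f ⁅x, y⁆ = 0) → x = 0 := by
  constructor
  · rintro ⟨f, hf⟩
    obtain ⟨g, rfl⟩ := f.exists_extend
    exact ⟨g, fun x hx h => congrArg Subtype.val (hf ⟨x, hx⟩ fun y => h y y.2)⟩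
  · rintro ⟨g, hg⟩
    exact ⟨g ∘ₗ S.toSubmodule.subtype,
      fun x hx => Subtype.ext (hg x x.2 fun y hy => hx ⟨y, hy⟩)⟩

theorem isFrobenius_prod_iff :
    IsFrobenius K (L × L') ↔ IsFrobenius K L ∧ IsFrobenius K L' := by
  constructor
  · rintro ⟨f, hf⟩
    refine ⟨⟨f ∘ₗ LinearMap.inl K L L', fun x hx => ?_⟩,
      ⟨f ∘ₗ LinearMap.inr K L L', fun x hx => ?_⟩⟩
    · refine congrArg Prod.fst (hf (x, 0) fun y => ?_)
      change f ⁅(x, (0 : L')), y⁆ = 0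
      rw [LieAlgebra.Prod.bracket_apply, zero_lie]
      exact hx y.1
    · refine congrArg Prod.snd (hf (0, x) fun y => ?_)
      change f ⁅((0 : L), x), y⁆ = 0
      rw [LieAlgebra.Prod.bracket_apply, zero_lie]
      exact hx y.2
  · rintro ⟨⟨f, hf⟩, ⟨g, hg⟩⟩
    refine ⟨f.coprod g, fun x hx => Prod.ext (hf _ fun y => ?_) (hg _ fun y => ?_)⟩
    · simpa [kirillovForm] using hx (y, 0)
    · simpa [kirillovForm] using hx (0, y)

theorem IsFrobenius.center_eq_bot (h : IsFrobenius K L) : LieAlgebra.center K L = ⊥ := by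
  obtain ⟨f, hf⟩ := h
  refine (LieSubmodule.eq_bot_iff _).mpr fun z hz => hf z fun y => ?_
  change f ⁅z, y⁆ = 0
  rw [← lie_skew, (LieModule.mem_maxTrivSubmodule K L L z).mp hz y, neg_zero, map_zero]

theorem isFrobenius_end_iff {V : Type*} [AddCommGroup V] [Module K V] :
    IsFrobenius K (Module.End K V) ↔ Subsingleton V := by
  constructor
  · intro h
    have hone : (1 : Module.End K V) ∈ LieAlgebra.center K (Module.End K V) := fun A => by
      rw [LieRing.of_associative_ring_bracket, mul_one, one_mul, sub_self]
    rw [h.center_eq_bot, LieSubmodule.mem_bot] at hone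
    exact ⟨fun v w => sub_eq_zero.mp (LinearMap.congr_fun hone (v - w))⟩
  · exact fun _ => ⟨0, fun A _ => Subsingleton.elim A 0⟩

end Frobenius

section Semidirect

variable {K : Type*} [Field K] {L M R : Type*} [LieRing L] [LieAlgebra K L] [AddCommGroup M]
  [Module K M] [LieRing R] [LieAlgebra K R]

/-- The stabilizer of a linear functional `ξ` on `M` under a representation of `L` on `M`. -/
def dualStabilizer (act : L →ₗ⁅K⁆ Module.End K M) (ξ : Module.Dual K M) : LieSubalgebra K L where
  carrier := {x | ∀ m, ξ (act x m) = 0}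
  add_mem' hx hy m := by rw [map_add, LinearMap.add_apply, map_add, hx, hy, add_zero]
  zero_mem' m := by rw [map_zero, LinearMap.zero_apply, map_zero]
  smul_mem' t x hx m := by rw [map_smul, LinearMap.smul_apply, map_smul, hx, smul_zero]
  lie_mem' hx hy m := by
    rw [LieHom.map_lie, LieRing.of_associative_ring_bracket, LinearMap.sub_apply, map_sub,
      Module.End.mul_apply, Module.End.mul_apply, hx, hy, sub_zero]

/-- A functional `ξ` on `M` has an open orbit under the coadjoint action of `L` if no nonzero
vector of `M` is orthogonal to the tangent space `{ξ ∘ act x}` of the orbit. -/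
def HasOpenOrbit (act : L →ₗ⁅K⁆ Module.End K M) (ξ : Module.Dual K M) : Prop :=
  ∀ m, (∀ x, ξ (act x m) = 0) → m = 0

/-- The Lie subalgebra `P` is the semidirect product of (the image under `ι` of) `L` and the
abelian ideal `M`, embedded by `κ`, on which `L` acts through `act`. -/
structure IsSemidirect (P : LieSubalgebra K R) (act : L →ₗ⁅K⁆ Module.End K M) (ι : L →ₗ⁅K⁆ R)
    (κ : M →ₗ[K] R) : Prop where
  mem_iff : ∀ p, p ∈ P ↔ ∃ x m, ι x + κ m = p
  eq_zero : ∀ x m, ι x + κ m = 0 → x = 0 ∧ m = 0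
  lie_act : ∀ x m, ⁅ι x, κ m⁆ = κ (act x m)
  lie_abelian : ∀ m m', ⁅κ m, κ m'⁆ = 0

theorem exists_eq_flip_of_ker_le [FiniteDimensional K M] (B : L →ₗ[K] M →ₗ[K] K)
    {g : Module.Dual K L} (h : LinearMap.ker B ≤ LinearMap.ker g) : ∃ m, B.flip m = g := by
  have hg : g ∈ (LinearMap.ker B).dualAnnihilator :=
    (Submodule.mem_dualAnnihilator g).mpr fun x hx => h hx
  rw [← LinearMap.range_dualMap_eq_dualAnnihilator_ker] at hg
  obtain ⟨φ, rfl⟩ := hg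
  obtain ⟨m, rfl⟩ := (Module.evalEquiv K M).surjective φ
  exact ⟨m, rfl⟩

namespace IsSemidirect

variable {P : LieSubalgebra K R} {act : L →ₗ⁅K⁆ Module.End K M} {ι : L →ₗ⁅K⁆ R} {κ : M →ₗ[K] R}

theorem lie_add_add (h : IsSemidirect P act ι κ) (x y : L) (m m' : M) :
    ⁅ι x + κ m, ι y + κ m'⁆ = ι ⁅x, y⁆ + κ (act x m' - act y m) := by
  rw [add_lie, lie_add, lie_add, h.lie_abelian, h.lie_act, ← lie_skew (κ m) (ι y), h.lie_act,
    LieHom.map_lie, map_sub]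
  abel

theorem isFrobenius_iff (h : IsSemidirect P act ι κ) : IsFrobenius K P ↔
    ∃ f : Module.Dual K R, ∀ x m,
      (∀ y m', f (ι ⁅x, y⁆) + f (κ (act x m' - act y m)) = 0) → x = 0 ∧ m = 0 := by
  rw [isFrobenius_coe_iff]
  refine exists_congr fun f => ⟨fun hf x m hxm => ?_, fun hf p hp hpP => ?_⟩
  · refine h.eq_zero x m (hf _ ((h.mem_iff _).mpr ⟨x, m, rfl⟩) fun q hq => ?_)
    obtain ⟨y, m', rfl⟩ := (h.mem_iff q).mp hq
    rw [h.lie_add_add, map_add, hxm]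
  · obtain ⟨x, m, rfl⟩ := (h.mem_iff p).mp hp
    obtain ⟨rfl, rfl⟩ := hf x m fun y m' => by
      rw [← map_add, ← h.lie_add_add]
      exact hpP _ ((h.mem_iff _).mpr ⟨y, m', rfl⟩)
    rw [map_zero, map_zero, add_zero]

theorem exists_dual_eq (h : IsSemidirect P act ι κ) (g : Module.Dual K L) (ξ : Module.Dual K M) :
    ∃ f : Module.Dual K R, (∀ x, f (ι x) = g x) ∧ ∀ m, f (κ m) = ξ m := by
  have hinj : LinearMap.ker ((ι : L →ₗ[K] R).coprod κ) = ⊥ :=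
    LinearMap.ker_eq_bot'.mpr fun p hp => Prod.ext_iff.mpr (h.eq_zero p.1 p.2 hp)
  obtain ⟨ρ, hρ⟩ := LinearMap.exists_leftInverse_of_injective _ hinj
  refine ⟨g.coprod ξ ∘ₗ ρ, fun x => ?_, fun m => ?_⟩
  · have hx : ρ (ι x) = (x, 0) := by simpa using LinearMap.congr_fun hρ (x, 0)
    rw [LinearMap.comp_apply, hx, LinearMap.coprod_apply, map_zero, add_zero]
  · have hm : ρ (κ m) = (0, m) := by simpa using LinearMap.congr_fun hρ (0, m)
    rw [LinearMap.comp_apply, hm, LinearMap.coprod_apply, map_zero, zero_add]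

theorem hasOpenOrbit_and_isFrobenius_dualStabilizer [FiniteDimensional K M]
    (h : IsSemidirect P act ι κ) (hP : IsFrobenius K P) :
    ∃ ξ, HasOpenOrbit act ξ ∧ IsFrobenius K (dualStabilizer act ξ) := by
  obtain ⟨f, hf⟩ := h.isFrobenius_iff.mp hP
  refine ⟨f ∘ₗ κ, fun m hm => (hf 0 m fun y m' => ?_).2,
    isFrobenius_coe_iff.mpr ⟨f ∘ₗ ι, fun x hx hxS => ?_⟩⟩
  · have : f (κ (act y m)) = 0 := hm y
    simp [this]
  let B : L →ₗ[K] M →ₗ[K] K := LinearMap.llcomp K M M K (f ∘ₗ κ) ∘ₗ (act : L →ₗ[K] Module.End K M)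
  -- On `L`, the functional `y ↦ f ⁅x, y⁆` coincides with `y ↦ f (act y m)` for some `m`.
  obtain ⟨m, hm⟩ := exists_eq_flip_of_ker_le B
    (g := f ∘ₗ ι ∘ₗ (LieAlgebra.ad K L x : L →ₗ[K] L)) fun y hy => by
      exact hxS y fun m => LinearMap.congr_fun hy m
  refine (hf x m fun y m' => ?_).1
  have hmy : f (κ (act y m)) = f (ι ⁅x, y⁆) := LinearMap.congr_fun hm y
  have hxm' : f (κ (act x m')) = 0 := hx m'
  rw [map_sub, map_sub, hmy, hxm']
  ring

/-- Raïs' criterion. -/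
theorem isFrobenius_iff_exists_hasOpenOrbit [FiniteDimensional K M]
    (h : IsSemidirect P act ι κ) : IsFrobenius K P ↔
      ∃ ξ, HasOpenOrbit act ξ ∧ IsFrobenius K (dualStabilizer act ξ) := by
  refine ⟨h.hasOpenOrbit_and_isFrobenius_dualStabilizer, fun ⟨ξ, hξ, hS⟩ => ?_⟩
  obtain ⟨g, hg⟩ := isFrobenius_coe_iff.mp hS
  obtain ⟨f, hfι, hfκ⟩ := h.exists_dual_eq g ξ
  refine h.isFrobenius_iff.mpr ⟨f, fun x m hxm => ?_⟩
  simp only [hfι, hfκ, map_sub] at hxm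
  have hx : x ∈ dualStabilizer act ξ := fun m' => by simpa using hxm 0 m'
  obtain rfl : x = 0 := hg x hx fun y hy => by simpa [hy m] using hxm y 0
  exact ⟨rfl, hξ m fun y => by simpa using hxm y 0⟩

end IsSemidirect

end Semidirect

section Intertwiners

variable {K : Type*} [Field K] {L R N Q : Type*} [LieRing L] [LieAlgebra K L] [LieRing R]
  [LieAlgebra K R] [AddCommGroup N] [Module K N] [AddCommGroup Q] [Module K Q]

/-- The trace pairing `ξ ↦ (φ ↦ tr (ξ ∘ φ))` between linear maps `N → Q` and `Q → N`. -/
noncomputable def traceDual : (N →ₗ[K] Q) →ₗ[K] Module.Dual K (Q →ₗ[K] N) :=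
  (LinearMap.llcomp K Q N Q).compr₂ (LinearMap.trace K Q)

theorem traceDual_smulRight [FiniteDimensional K Q] (ξ : N →ₗ[K] Q) (l : Module.Dual K Q) (v : N) :
    traceDual ξ (l.smulRight v) = l (ξ v) := by
  have hcomp : ξ ∘ₗ l.smulRight v = l.smulRight (ξ v) := by ext; simp
  exact (congrArg _ hcomp).trans (LinearMap.trace_smulRight l (ξ v))

theorem traceDual_injective [FiniteDimensional K Q] :
    Function.Injective (traceDual (K := K) (N := N) (Q := Q)) := by
  refine (injective_iff_map_eq_zero _).mpr fun ξ hξ => LinearMap.ext fun v => ?_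
  refine (Module.forall_dual_apply_eq_zero_iff K (ξ v)).mp fun l => ?_
  rw [← traceDual_smulRight, hξ, LinearMap.zero_apply]

theorem traceDual_bijective [FiniteDimensional K N] [FiniteDimensional K Q] :
    Function.Bijective (traceDual (K := K) (N := N) (Q := Q)) := by
  refine ⟨traceDual_injective, (LinearMap.injective_iff_surjective_of_finrank_eq_finrank ?_).mp
    traceDual_injective⟩
  rw [Subspace.dual_finrank_eq, Module.finrank_linearMap, Module.finrank_linearMap, mul_comm]

/-- The action `x • φ = τ x ∘ φ - φ ∘ σ x` of `L` on linear maps `φ : Q → N`, where `τ` and `σ` are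
representations on `N` and `Q`. -/
def homRep (τ : L →ₗ⁅K⁆ Module.End K N) (σ : L →ₗ⁅K⁆ Module.End K Q) :
    L →ₗ⁅K⁆ Module.End K (Q →ₗ[K] N) where
  toFun x :=
    { toFun φ := τ x ∘ₗ φ - φ ∘ₗ σ x
      map_add' φ ψ := by rw [LinearMap.comp_add, LinearMap.add_comp]; abel
      map_smul' t φ := by rw [LinearMap.comp_smul, LinearMap.smul_comp, smul_sub]; rfl }
  map_add' x y := by ext φ q; simp; abel
  map_smul' t x := by ext φ q; simp [smul_sub]
  map_lie' {x y} := by ext φ q; simp [LieRing.of_associative_ring_bracket]; abel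

theorem homRep_apply (τ : L →ₗ⁅K⁆ Module.End K N) (σ : L →ₗ⁅K⁆ Module.End K Q) (x : L)
    (φ : Q →ₗ[K] N) : homRep τ σ x φ = τ x ∘ₗ φ - φ ∘ₗ σ x := rfl

/-- The elements of `L` whose actions on `N` and `Q`, through `τ` and `σ`, are intertwined by
`ξ : N → Q`. -/
def intertwiners (τ : L →ₗ⁅K⁆ Module.End K N) (σ : L →ₗ⁅K⁆ Module.End K Q) (ξ : N →ₗ[K] Q) :
    LieSubalgebra K L where
  carrier := {x | ∀ v, ξ (τ x v) = σ x (ξ v)}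
  add_mem' hx hy v := by
    rw [map_add, map_add, LinearMap.add_apply, LinearMap.add_apply, map_add, hx, hy]
  zero_mem' v := by simp
  smul_mem' t x hx v := by
    rw [map_smul, map_smul, LinearMap.smul_apply, LinearMap.smul_apply, map_smul, hx]
  lie_mem' hx hy v := by
    simp only [LieHom.map_lie, LieRing.of_associative_ring_bracket, LinearMap.sub_apply,
      Module.End.mul_apply, map_sub, hx _, hy _]

variable {τ : L →ₗ⁅K⁆ Module.End K N} {σ : L →ₗ⁅K⁆ Module.End K Q}

theorem traceDual_homRep (ξ : N →ₗ[K] Q) (x : L) (φ : Q →ₗ[K] N) :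
    traceDual ξ (homRep τ σ x φ) = traceDual (ξ ∘ₗ τ x - σ x ∘ₗ ξ) φ := by
  have hcomm := LinearMap.trace_mul_comm K (ξ ∘ₗ φ) (σ x)
  rw [homRep_apply, map_sub, map_sub, LinearMap.sub_apply]
  exact congrArg _ hcomm

theorem dualStabilizer_homRep [FiniteDimensional K Q] (ξ : N →ₗ[K] Q) :
    dualStabilizer (homRep τ σ) (traceDual ξ) = intertwiners τ σ ξ := by
  ext x
  calc x ∈ dualStabilizer (homRep τ σ) (traceDual ξ)
    _ ↔ ∀ φ, traceDual (ξ ∘ₗ τ x - σ x ∘ₗ ξ) φ = 0 := by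
      simp only [← traceDual_homRep]; rfl
    _ ↔ ξ ∘ₗ τ x - σ x ∘ₗ ξ = 0 := by
      rw [← map_eq_zero_iff _ traceDual_injective]
      exact ⟨fun h => LinearMap.ext h, fun h φ => LinearMap.congr_fun h φ⟩
    _ ↔ x ∈ intertwiners τ σ ξ := by
      rw [sub_eq_zero, LinearMap.ext_iff]; rfl

theorem IsSemidirect.isFrobenius_iff_exists_intertwiners [FiniteDimensional K N]
    [FiniteDimensional K Q] {P : LieSubalgebra K R} {ι : L →ₗ⁅K⁆ R} {κ : (Q →ₗ[K] N) →ₗ[K] R}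
    (h : IsSemidirect P (homRep τ σ) ι κ) :
    IsFrobenius K P ↔ ∃ ξ : N →ₗ[K] Q,
      HasOpenOrbit (homRep τ σ) (traceDual ξ) ∧ IsFrobenius K (intertwiners τ σ ξ) := by
  rw [h.isFrobenius_iff_exists_hasOpenOrbit, traceDual_bijective.surjective.exists]
  exact exists_congr fun ξ => by rw [dualStabilizer_homRep]

end Intertwiners

section BlockTriangular

variable {K : Type*} [Field K] {L V N Q : Type*} [LieRing L] [LieAlgebra K L] [AddCommGroup V]
  [Module K V] [AddCommGroup N] [Module K N] [AddCommGroup Q] [Module K Q]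

/-- The block-diagonal action of `L` on `V ≃ N × Q`. -/
def blockDiag (e : V ≃ₗ[K] N × Q) (τ : L →ₗ⁅K⁆ Module.End K N) (σ : L →ₗ⁅K⁆ Module.End K Q) :
    L →ₗ⁅K⁆ Module.End K V :=
  e.symm.lieConj.toLieHom.comp
    { toFun x := (τ x).prodMap (σ x)
      map_add' x y := by simp [LinearMap.prodMap_add]
      map_smul' t x := by simp [LinearMap.prodMap_smul]
      map_lie' {x y} := by ext <;> simp [LieRing.of_associative_ring_bracket] }

/-- The endomorphism of `V ≃ N × Q` with upper right block `φ` and zeros elsewhere. -/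
def blockUpper (e : V ≃ₗ[K] N × Q) : (Q →ₗ[K] N) →ₗ[K] Module.End K V where
  toFun φ := e.symm ∘ₗ LinearMap.inl K N Q ∘ₗ φ ∘ₗ LinearMap.snd K N Q ∘ₗ e
  map_add' φ ψ := by rw [LinearMap.add_comp, LinearMap.comp_add, LinearMap.comp_add]
  map_smul' t φ := by rw [LinearMap.smul_comp, LinearMap.comp_smul, LinearMap.comp_smul]; rfl

variable (e : V ≃ₗ[K] N × Q) {τ : L →ₗ⁅K⁆ Module.End K N} {σ : L →ₗ⁅K⁆ Module.End K Q}

theorem blockDiag_add_blockUpper_apply (x : L) (φ : Q →ₗ[K] N) (v : V) :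
    e ((blockDiag e τ σ x + blockUpper e φ) v) = (τ x (e v).1 + φ (e v).2, σ x (e v).2) := by
  simp [blockDiag, blockUpper]

theorem blockDiag_add_blockUpper_eq_iff {x : L} {φ : Q →ₗ[K] N} {T : Module.End K V} :
    blockDiag e τ σ x + blockUpper e φ = T ↔
      (∀ v, e (T (e.symm (v, 0))) = (τ x v, 0)) ∧ ∀ q, e (T (e.symm (0, q))) = (φ q, σ x q) := by
  constructor
  · rintro rfl
    exact ⟨fun v => by rw [blockDiag_add_blockUpper_apply]; simp,
      fun q => by rw [blockDiag_add_blockUpper_apply]; simp⟩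
  · refine fun ⟨hN, hQ⟩ => LinearMap.ext fun v => e.injective ?_
    obtain ⟨p, rfl⟩ := e.symm.surjective v
    have hp : p = (p.1, 0) + (0, p.2) := by simp
    rw [blockDiag_add_blockUpper_apply, e.apply_symm_apply, hp, map_add, map_add, map_add, hN, hQ]
    simp

theorem blockDiag_eq_iff {x : L} {T : Module.End K V} :
    blockDiag e τ σ x = T ↔
      (∀ v, e (T (e.symm (v, 0))) = (τ x v, 0)) ∧ ∀ q, e (T (e.symm (0, q))) = (0, σ x q) := by
  simpa using blockDiag_add_blockUpper_eq_iff e (τ := τ) (σ := σ) (x := x) (φ := 0) (T := T)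

theorem lie_blockDiag_blockUpper (x : L) (φ : Q →ₗ[K] N) :
    ⁅blockDiag e τ σ x, blockUpper e φ⁆ = blockUpper e (homRep τ σ x φ) := by
  ext v
  simp [LieRing.of_associative_ring_bracket, blockDiag, blockUpper, ← map_sub,
    homRep_apply (K := K) (L := L) (N := N) (Q := Q)]

theorem lie_blockUpper_blockUpper (φ ψ : Q →ₗ[K] N) : ⁅blockUpper e φ, blockUpper e ψ⁆ = 0 := by
  ext v
  simp [LieRing.of_associative_ring_bracket, blockUpper]

end BlockTriangular

section Extensions

variable {K : Type*} [Field K] {L V X Z N O : Type*} [LieRing L] [LieAlgebra K L] [AddCommGroup V]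
  [Module K V] [AddCommGroup X] [Module K X] [AddCommGroup Z] [Module K Z] [AddCommGroup N]
  [Module K N] [AddCommGroup O] [Module K O]

/-- The pairs of `x ∈ L` and an endomorphism of `V` that induces the action of `x` on `Z` along
`π : V → Z`. -/
def quotExt (ρ : L →ₗ⁅K⁆ Module.End K Z) (π : V →ₗ[K] Z) : LieSubalgebra K (L × Module.End K V) :=
  intertwiners (LieHom.snd K L (Module.End K V)) (ρ.comp (LieHom.fst K L (Module.End K V))) π

/-- The pairs of `x ∈ L` and an endomorphism of `V` that extends the action of `x` on `X` along
`i : X → V`. -/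
def subExt (ρ : L →ₗ⁅K⁆ Module.End K X) (i : X →ₗ[K] V) : LieSubalgebra K (L × Module.End K V) :=
  intertwiners (ρ.comp (LieHom.fst K L (Module.End K V))) (LieHom.snd K L (Module.End K V)) i

theorem mem_quotExt {ρ : L →ₗ⁅K⁆ Module.End K Z} {π : V →ₗ[K] Z} {p : L × Module.End K V} :
    p ∈ quotExt ρ π ↔ ∀ v, π (p.2 v) = ρ p.1 (π v) := Iff.rfl

theorem mem_subExt {ρ : L →ₗ⁅K⁆ Module.End K X} {i : X →ₗ[K] V} {p : L × Module.End K V} :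
    p ∈ subExt ρ i ↔ ∀ v, i (ρ p.1 v) = p.2 (i v) := Iff.rfl

theorem isSemidirect_quotExt (ρ : L →ₗ⁅K⁆ Module.End K Z) (e : V ≃ₗ[K] N × Z) :
    IsSemidirect (quotExt ρ (LinearMap.snd K N Z ∘ₗ e.toLinearMap))
      (homRep (LieHom.snd K L (Module.End K N)) (ρ.comp (LieHom.fst K L (Module.End K N))))
      ((LieHom.fst K L (Module.End K N)).prod
        (blockDiag e (LieHom.snd K L (Module.End K N)) (ρ.comp (LieHom.fst K L (Module.End K N)))))
      (LinearMap.inr K L (Module.End K V) ∘ₗ blockUpper e) where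
  mem_iff p := by
    let T : Module.End K (N × Z) := e.conj p.2
    refine ⟨fun hp => ⟨(p.1, LinearMap.fst K N Z ∘ₗ T ∘ₗ LinearMap.inl K N Z),
      LinearMap.fst K N Z ∘ₗ T ∘ₗ LinearMap.inr K N Z, Prod.ext (add_zero _)
      ((blockDiag_add_blockUpper_eq_iff e).mpr
        ⟨fun v => Prod.ext rfl ?_, fun z => Prod.ext rfl ?_⟩)⟩, ?_⟩
    · exact (hp _).trans (by simp)
    · exact (hp _).trans (by simp)
    · rintro ⟨y, φ, rfl⟩ v
      exact (congrArg Prod.snd (blockDiag_add_blockUpper_apply e y φ v)).trans (by simp)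
  eq_zero y φ h := by
    obtain ⟨hN, hZ⟩ := (blockDiag_add_blockUpper_eq_iff e).mp (congrArg Prod.snd h)
    refine ⟨Prod.ext ((add_zero _).symm.trans (congrArg Prod.fst h)) (LinearMap.ext fun v => ?_),
      LinearMap.ext fun z => ?_⟩
    · exact (congrArg Prod.fst (hN v)).symm.trans (by simp)
    · exact (congrArg Prod.fst (hZ z)).symm.trans (by simp)
  lie_act y φ := Prod.ext (lie_zero y.1) (lie_blockDiag_blockUpper e y φ)
  lie_abelian φ ψ := Prod.ext (lie_zero _) (lie_blockUpper_blockUpper e φ ψ)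

theorem isSemidirect_subExt (ρ : L →ₗ⁅K⁆ Module.End K X) (e : V ≃ₗ[K] X × O) :
    IsSemidirect (subExt ρ (e.symm.toLinearMap ∘ₗ LinearMap.inl K X O))
      (homRep (ρ.comp (LieHom.fst K L (Module.End K O))) (LieHom.snd K L (Module.End K O)))
      ((LieHom.fst K L (Module.End K O)).prod
        (blockDiag e (ρ.comp (LieHom.fst K L (Module.End K O))) (LieHom.snd K L (Module.End K O))))
      (LinearMap.inr K L (Module.End K V) ∘ₗ blockUpper e) where
  mem_iff p := by
    let T : Module.End K (X × O) := e.conj p.2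
    refine ⟨fun hp => ⟨(p.1, LinearMap.snd K X O ∘ₗ T ∘ₗ LinearMap.inr K X O),
      LinearMap.fst K X O ∘ₗ T ∘ₗ LinearMap.inr K X O, Prod.ext (add_zero _)
      ((blockDiag_add_blockUpper_eq_iff e).mpr ⟨fun v => ?_, fun o => rfl⟩)⟩, ?_⟩
    · exact (congrArg e (hp v)).symm.trans (e.apply_symm_apply _)
    · rintro ⟨y, φ, rfl⟩ v
      refine e.injective (Eq.trans ?_ (blockDiag_add_blockUpper_apply e y φ _).symm)
      simp
  eq_zero y φ h := by
    obtain ⟨-, hO⟩ := (blockDiag_add_blockUpper_eq_iff e).mp (congrArg Prod.snd h)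
    refine ⟨Prod.ext ((add_zero _).symm.trans (congrArg Prod.fst h)) (LinearMap.ext fun o => ?_),
      LinearMap.ext fun o => ?_⟩
    · exact (congrArg Prod.snd (hO o)).symm.trans (by simp)
    · exact (congrArg Prod.fst (hO o)).symm.trans (by simp)
  lie_act y φ := Prod.ext (lie_zero y.1) (lie_blockDiag_blockUpper e y φ)
  lie_abelian φ ψ := Prod.ext (lie_zero _) (lie_blockUpper_blockUpper e φ ψ)

theorem hasOpenOrbit_quotExt_iff [FiniteDimensional K N] [FiniteDimensional K Z]
    (ρ : L →ₗ⁅K⁆ Module.End K Z) (ξ : N →ₗ[K] Z) :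
    HasOpenOrbit (homRep (LieHom.snd K L (Module.End K N))
        (ρ.comp (LieHom.fst K L (Module.End K N)))) (traceDual ξ) ↔
      ∀ φ : Z →ₗ[K] N, φ ∘ₗ ξ = 0 → (∀ x, traceDual ξ (φ ∘ₗ ρ x) = 0) → φ = 0 := by
  refine forall_congr' fun φ => ?_
  have hact (x : L) (B : Module.End K N) :
      traceDual ξ (B ∘ₗ φ - φ ∘ₗ ρ x) = traceDual (φ ∘ₗ ξ) B - traceDual ξ (φ ∘ₗ ρ x) := by
    rw [map_sub]
    exact congrArg (· - _) (LinearMap.trace_comp_comm' φ (ξ ∘ₗ B))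
  rw [← and_imp]
  refine imp_congr_left ⟨fun h => ?_, fun ⟨hφ, hρ⟩ y => ?_⟩
  · have hB (x B) := (hact x B).symm.trans (h (x, B))
    exact ⟨traceDual_injective (LinearMap.ext fun B => by simpa using hB 0 B),
      fun x => by simpa using hB x 0⟩
  · exact (hact y.1 y.2).trans (by rw [hφ, hρ, map_zero, LinearMap.zero_apply, sub_zero])

theorem hasOpenOrbit_subExt_iff [FiniteDimensional K O]
    (ρ : L →ₗ⁅K⁆ Module.End K X) (ξ : X →ₗ[K] O) :
    HasOpenOrbit (homRep (ρ.comp (LieHom.fst K L (Module.End K O)))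
        (LieHom.snd K L (Module.End K O))) (traceDual ξ) ↔
      ∀ φ : O →ₗ[K] X, ξ ∘ₗ φ = 0 → (∀ x, traceDual ξ (ρ x ∘ₗ φ) = 0) → φ = 0 := by
  refine forall_congr' fun φ => ?_
  have hact (x : L) (B : Module.End K O) :
      traceDual ξ (ρ x ∘ₗ φ - φ ∘ₗ B) = traceDual ξ (ρ x ∘ₗ φ) - traceDual (ξ ∘ₗ φ) B :=
    map_sub _ _ _
  rw [← and_imp]
  refine imp_congr_left ⟨fun h => ?_, fun ⟨hφ, hρ⟩ y => ?_⟩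
  · have hB (x B) := (hact x B).symm.trans (h (x, B))
    exact ⟨traceDual_injective (LinearMap.ext fun B => by simpa using hB 0 B),
      fun x => by simpa using hB x 0⟩
  · exact (hact y.1 y.2).trans (by rw [hφ, hρ, map_zero, LinearMap.zero_apply, sub_zero])

theorem isFrobenius_quotExt_iff [FiniteDimensional K V] [FiniteDimensional K Z]
    (ρ : L →ₗ⁅K⁆ Module.End K Z) {π : V →ₗ[K] Z} (hπ : Function.Surjective π) :
    IsFrobenius K (quotExt ρ π) ↔ ∃ ξ : LinearMap.ker π →ₗ[K] Z,
      (∀ φ : Z →ₗ[K] LinearMap.ker π, φ ∘ₗ ξ = 0 →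
        (∀ x, traceDual ξ (φ ∘ₗ ρ x) = 0) → φ = 0) ∧ IsFrobenius K (quotExt ρ ξ) := by
  obtain ⟨e, -, he⟩ := ((π.exact_subtype_ker_map.split_tfae
    (Submodule.subtype_injective _) hπ).out 0 2).mp (π.exists_rightInverse_of_surjective
      (LinearMap.range_eq_top.mpr hπ))
  have hsemi := isSemidirect_quotExt ρ e
  rw [← he] at hsemi
  rw [hsemi.isFrobenius_iff_exists_intertwiners]
  simp only [hasOpenOrbit_quotExt_iff]
  rfl

theorem isFrobenius_subExt_iff [FiniteDimensional K V] [FiniteDimensional K X]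
    (ρ : L →ₗ⁅K⁆ Module.End K X) {i : X →ₗ[K] V} (hi : Function.Injective i) :
    IsFrobenius K (subExt ρ i) ↔ ∃ ξ : X →ₗ[K] V ⧸ LinearMap.range i,
      (∀ φ : V ⧸ LinearMap.range i →ₗ[K] X, ξ ∘ₗ φ = 0 →
        (∀ x, traceDual ξ (ρ x ∘ₗ φ) = 0) → φ = 0) ∧ IsFrobenius K (subExt ρ ξ) := by
  obtain ⟨e, he, -⟩ := ((i.exact_map_mkQ_range.split_tfae hi
    (Submodule.mkQ_surjective _)).out 1 2).mp (i.exists_leftInverse_of_injective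
      (LinearMap.ker_eq_bot.mpr hi))
  have hsemi := isSemidirect_subExt ρ e
  rw [← he] at hsemi
  rw [hsemi.isFrobenius_iff_exists_intertwiners]
  simp only [hasOpenOrbit_subExt_iff]
  rfl

end Extensions

section Orthogonal

variable {K : Type*} [Field K] {V : Type*} [AddCommGroup V] [Module K V]
  {Q : LinearMap.BilinForm K V}

theorem mem_skewAdjoint_iff {A : Module.End K V} :
    A ∈ skewAdjointLieSubalgebra Q ↔ ∀ x y, Q (A x) y + Q x (A y) = 0 := by
  refine (LinearMap.mem_skewAdjointSubmodule A).trans (forall₂_congr fun x y => ?_)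
  rw [Pi.neg_apply, map_neg, eq_neg_iff_add_eq_zero]

/-- The endomorphism of rank at most two attached to two vectors; it is skew-adjoint when `Q` is
symmetric. -/
def skewPair (Q : LinearMap.BilinForm K V) (x y : V) : Module.End K V :=
  (Q x).smulRight y - (Q y).smulRight x

theorem skewPair_apply (x y v : V) : skewPair Q x y v = Q x v • y - Q y v • x := rfl

theorem skewPair_mem_skewAdjoint (hQ : Q.IsSymm) (x y : V) :
    skewPair Q x y ∈ skewAdjointLieSubalgebra Q := by
  refine mem_skewAdjoint_iff.mpr fun v w => ?_
  simp only [skewPair_apply, map_sub, LinearMap.sub_apply, map_smul, LinearMap.smul_apply,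
    smul_eq_mul, hQ.eq v]
  ring

variable [FiniteDimensional K V]

theorem trace_eq_of_isAdjointPair (hn : Q.Nondegenerate) {F G : Module.End K V}
    (h : LinearMap.IsAdjointPair Q Q F G) : LinearMap.trace K V F = LinearMap.trace K V G := by
  have hF : F = (Q.toDual hn).symm.conj (Module.Dual.transpose G) :=
    LinearMap.ext fun x => (Q.toDual hn).injective (LinearMap.ext fun y => by
      rw [LinearEquiv.conj_apply_apply, LinearEquiv.apply_symm_apply]
      exact h x y)
  rw [hF, LinearMap.trace_conj', LinearMap.trace_transpose']

theorem exists_mem_skewAdjoint_trace_eq [NeZero (2 : K)] (hQ : Q.IsSymm) (hn : Q.Nondegenerate)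
    (f : Module.Dual K (Module.End K V)) :
    ∃ G ∈ skewAdjointLieSubalgebra Q, ∀ A ∈ skewAdjointLieSubalgebra Q,
      f A = LinearMap.trace K V (G * A) := by
  obtain ⟨F, rfl⟩ := traceDual_bijective.surjective f
  let F' := Q.leftAdjointOfNondegenerate hn F
  have hF' (x y) : Q (F' x) y = Q x (F y) := Q.isAdjointPairLeftAdjointOfNondegenerate hn F x y
  refine ⟨(2 : K)⁻¹ • (F - F'), Submodule.smul_mem _ _ (mem_skewAdjoint_iff.mpr fun x y => ?_),
    fun A hA => ?_⟩
  · have hyx : Q (F x) y = Q x (F' y) := by rw [hQ.eq, ← hF', hQ.eq]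
    simp only [LinearMap.sub_apply, map_sub, hF', hyx]
    ring
  · have htr : LinearMap.trace K V (-(F' * A)) = LinearMap.trace K V (A * F) :=
      trace_eq_of_isAdjointPair hn fun x y => by
        simpa [hF', neg_eq_iff_add_eq_zero] using mem_skewAdjoint_iff.mp hA x (F y)
    rw [map_neg, LinearMap.trace_mul_comm K A F] at htr
    rw [smul_mul_assoc, map_smul, sub_mul, map_sub, sub_eq_add_neg, htr, ← two_smul K,
      inv_smul_smul₀ two_ne_zero]
    rfl

theorem IsFrobenius.skewAdjoint_eq_bot [NeZero (2 : K)] (hQ : Q.IsSymm) (hn : Q.Nondegenerate)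
    (h : IsFrobenius K (skewAdjointLieSubalgebra Q)) : skewAdjointLieSubalgebra Q = ⊥ := by
  obtain ⟨f, hf⟩ := isFrobenius_coe_iff.mp h
  obtain ⟨G, hG, hfG⟩ := exists_mem_skewAdjoint_trace_eq hQ hn f
  obtain rfl : G = 0 := hf G hG fun A hA => by
    have hcomm := LinearMap.trace_mul_comm K (G * A) G
    rw [hfG _ (LieSubalgebra.lie_mem _ hG hA), LieRing.of_associative_ring_bracket, mul_sub,
      map_sub, ← hcomm, mul_assoc, sub_self]
  refine (LieSubalgebra.eq_bot_iff _).mpr fun A hA => hf A hA fun B hB => ?_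
  rw [hfG _ (LieSubalgebra.lie_mem _ hA hB), zero_mul, map_zero]

theorem skewAdjoint_eq_bot_iff [NeZero (2 : K)] (hQ : Q.IsSymm) (hn : Q.Nondegenerate) :
    skewAdjointLieSubalgebra Q = ⊥ ↔ Module.finrank K V ≤ 1 := by
  rw [finrank_le_one_iff, LieSubalgebra.eq_bot_iff]
  constructor
  · intro h
    by_cases! hV : ∃ x : V, x ≠ 0
    · obtain ⟨x, hx⟩ := hV
      obtain ⟨v, hv⟩ : ∃ v, Q x v ≠ 0 := by
        by_contra! hx0
        exact hx (hn.1 x hx0)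
      refine ⟨x, fun y => ⟨(Q x v)⁻¹ * Q y v, ?_⟩⟩
      have := LinearMap.congr_fun (h _ (skewPair_mem_skewAdjoint hQ x y)) v
      rw [skewPair_apply, LinearMap.zero_apply, sub_eq_zero] at this
      rw [mul_smul, ← this, inv_smul_smul₀ hv]
    · exact ⟨0, fun y => ⟨0, (smul_zero _).trans (hV y).symm⟩⟩
  · rintro ⟨v, hv⟩ A hA
    have hvv : Q (A v) v = 0 := by
      have := mem_skewAdjoint_iff.mp hA v v
      rw [hQ.eq v, ← two_mul] at this
      exact (mul_eq_zero.mp this).resolve_left two_ne_zero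
    have hAv : A v = 0 := hn.1 _ fun w => by
      obtain ⟨c, rfl⟩ := hv w
      rw [map_smul, hvv, smul_zero]
    refine LinearMap.ext fun w => ?_
    obtain ⟨c, rfl⟩ := hv w
    rw [map_smul, hAv, smul_zero, LinearMap.zero_apply]

theorem isFrobenius_skewAdjoint_iff [NeZero (2 : K)] (hQ : Q.IsSymm) (hn : Q.Nondegenerate) :
    IsFrobenius K (skewAdjointLieSubalgebra Q) ↔ Module.finrank K V ≤ 1 := by
  rw [← skewAdjoint_eq_bot_iff hQ hn]
  refine ⟨fun h => h.skewAdjoint_eq_bot hQ hn,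
    fun h => isFrobenius_coe_iff.mpr ⟨0, fun A hA _ => ?_⟩⟩
  rwa [h, LieSubalgebra.mem_bot] at hA

end Orthogonal

section Stabilizers

variable {K : Type*} [Field K] {V : Type*} [AddCommGroup V] [Module K V]

/-- The endomorphisms of `V` that preserve the subspace `U`. -/
def stab (U : Submodule K V) : LieSubalgebra K (Module.End K V) where
  carrier := {A | ∀ u ∈ U, A u ∈ U}
  add_mem' hA hB u hu := U.add_mem (hA u hu) (hB u hu)
  zero_mem' _ _ := U.zero_mem
  smul_mem' t _ hA u hu := U.smul_mem t (hA u hu)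
  lie_mem' hA hB u hu := U.sub_mem (hA _ (hB u hu)) (hB _ (hA u hu))

/-- The endomorphisms of `V` that preserve the subspace `W` and are skew-adjoint on it with respect
to the bilinear form `Q`. -/
def skewStab (W : Submodule K V) (Q : LinearMap.BilinForm K V) :
    LieSubalgebra K (Module.End K V) where
  carrier := {A | (∀ w ∈ W, A w ∈ W) ∧ ∀ w ∈ W, ∀ w' ∈ W, Q (A w) w' + Q w (A w') = 0}
  add_mem' {A B} hA hB := by
    refine ⟨fun w hw => W.add_mem (hA.1 w hw) (hB.1 w hw), fun w hw w' hw' => ?_⟩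
    simp only [LinearMap.add_apply, map_add]
    linear_combination hA.2 w hw w' hw' + hB.2 w hw w' hw'
  zero_mem' := ⟨fun _ _ => W.zero_mem, fun _ _ _ _ => by simp⟩
  smul_mem' t A hA := by
    refine ⟨fun w hw => W.smul_mem t (hA.1 w hw), fun w hw w' hw' => ?_⟩
    simp only [LinearMap.smul_apply, map_smul, smul_eq_mul]
    linear_combination t * hA.2 w hw w' hw'
  lie_mem' {A B} hA hB := by
    refine ⟨fun w hw => W.sub_mem (hA.1 _ (hB.1 w hw)) (hB.1 _ (hA.1 w hw)),
      fun w hw w' hw' => ?_⟩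
    simp only [LieRing.of_associative_ring_bracket, LinearMap.sub_apply, Module.End.mul_apply,
      map_sub]
    linear_combination hA.2 w hw (B w') (hB.1 _ hw') + hA.2 (B w) (hB.1 _ hw) w' hw' -
      hB.2 w hw (A w') (hA.1 _ hw') - hB.2 (A w) (hA.1 _ hw) w' hw'

variable {U W : Submodule K V} {Q : LinearMap.BilinForm K V}

theorem skewStab_top : skewStab ⊤ Q = skewAdjointLieSubalgebra Q := by
  ext A
  rw [mem_skewAdjoint_iff]
  exact ⟨fun hA x y => hA.2 x trivial y trivial,
    fun hA => ⟨fun _ _ => trivial, fun x _ y _ => hA x y⟩⟩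

/-- The restriction of the bilinear form `Q` to `W` has trivial left kernel. -/
def NondegOn (Q : LinearMap.BilinForm K V) (W : Submodule K V) : Prop :=
  ∀ w ∈ W, (∀ w' ∈ W, Q w w' = 0) → w = 0

theorem nondegOn_iff (hQ : Q.IsSymm) : NondegOn Q W ↔ (Q.restrict W).Nondegenerate := by
  refine Iff.trans ⟨fun h w hw => ?_, fun h w hw hww => ?_⟩
    (hQ.restrict W).isRefl.nondegenerate_iff_separatingLeft.symm
  · exact Subtype.ext (h w w.2 fun w' hw' => hw ⟨w', hw'⟩)
  · exact congrArg Subtype.val (h ⟨w, hw⟩ fun w' => hww w' w'.2)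

theorem nondegOn_comap_subtype (h : NondegOn Q (U ⊓ W)) :
    NondegOn (Q.restrict U) (W.comap U.subtype) := fun w hw hww =>
  Subtype.ext (h w ⟨w.2, hw⟩ fun v hv => hww ⟨v, hv.1⟩ hv.2)

/-- The action on `V ⧸ W` of the endomorphisms that preserve `W`. -/
def quotRep (W : Submodule K V) (Q : LinearMap.BilinForm K V) :
    skewStab W Q →ₗ⁅K⁆ Module.End K (V ⧸ W) where
  toFun A := W.mapQ W A A.2.1
  map_add' _ _ := W.linearMap_qext rfl
  map_smul' _ _ := W.linearMap_qext rfl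
  map_lie' := W.linearMap_qext rfl

theorem quotRep_mkQ (A : skewStab W Q) (v : V) :
    quotRep W Q A (W.mkQ v) = W.mkQ ((A : Module.End K V) v) := rfl

theorem quotRep_surjective : Function.Surjective (quotRep W Q) := by
  intro B
  obtain ⟨s, hs⟩ := W.mkQ.exists_rightInverse_of_surjective W.range_mkQ
  have hW (w) (hw : w ∈ W) : (s ∘ₗ B ∘ₗ W.mkQ) w = 0 := by
    have : W.mkQ w = 0 := (Submodule.Quotient.mk_eq_zero W).mpr hw
    rw [LinearMap.comp_apply, LinearMap.comp_apply, this, map_zero, map_zero]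
  refine ⟨⟨s ∘ₗ B ∘ₗ W.mkQ, fun w hw => ?_, fun w hw w' hw' => ?_⟩, W.linearMap_qext ?_⟩
  · rw [hW w hw]
    exact W.zero_mem
  · rw [hW w hw, hW w' hw', map_zero, map_zero, LinearMap.zero_apply, add_zero]
  · exact LinearMap.ext fun v => LinearMap.congr_fun hs _

end Stabilizers

section Identifications

variable {K : Type*} [Field K] {V X Y : Type*} [AddCommGroup V] [Module K V] [AddCommGroup X]
  [Module K X] [AddCommGroup Y] [Module K Y]

theorem isFrobenius_quotExt_quotRep_iff_of_injective {W : Submodule K X}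
    {Q : LinearMap.BilinForm K X} {ξ : Y →ₗ[K] X ⧸ W} (hξ : Function.Injective ξ) :
    IsFrobenius K (quotExt (quotRep W Q) ξ) ↔
      IsFrobenius K ↥(stab ((LinearMap.range ξ).comap W.mkQ) ⊓ skewStab W Q) := by
  let φ : quotExt (quotRep W Q) ξ →ₗ⁅K⁆ Module.End K X :=
    (skewStab W Q).incl.comp
      ((LieHom.fst K (skewStab W Q) (Module.End K Y)).comp (quotExt (quotRep W Q) ξ).incl)
  have hφ : Function.Injective φ := (injective_iff_map_eq_zero _).mpr fun p hp => by
    have hp1 : p.1.1 = 0 := Subtype.ext hp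
    refine Subtype.ext (Prod.ext hp1 (LinearMap.ext fun y => hξ ?_))
    rw [mem_quotExt.mp p.2 y, hp1]
    simp
  have hrange : φ.range = stab ((LinearMap.range ξ).comap W.mkQ) ⊓ skewStab W Q := by
    ext A
    rw [LieHom.mem_range, LieSubalgebra.mem_inf]
    constructor
    · rintro ⟨p, rfl⟩
      refine ⟨?_, p.1.1.2⟩
      rintro v ⟨y, hy⟩
      exact ⟨p.1.2 y, (mem_quotExt.mp p.2 y).trans (by rw [hy]; rfl)⟩
    · rintro ⟨hA, hAW⟩
      obtain ⟨l, hl⟩ := ξ.exists_leftInverse_of_injective (LinearMap.ker_eq_bot.mpr hξ)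
      refine ⟨⟨(⟨A, hAW⟩, l ∘ₗ quotRep W Q ⟨A, hAW⟩ ∘ₗ ξ), mem_quotExt.mpr fun y => ?_⟩, rfl⟩
      obtain ⟨v, hv⟩ := W.mkQ_surjective (ξ y)
      obtain ⟨y', hy'⟩ := hA v ⟨y, hv.symm⟩
      have hly' : l (ξ y') = y' := LinearMap.congr_fun hl y'
      simp only [LinearMap.comp_apply, ← hv, quotRep_mkQ, ← hy', hly']
  rw [← hrange, isFrobenius_range_iff hφ]

theorem isFrobenius_subExt_incl_iff_of_surjective (s : LieSubalgebra K (Module.End K X))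
    {ξ : X →ₗ[K] Y} (hξ : Function.Surjective ξ) :
    IsFrobenius K (subExt s.incl ξ) ↔ IsFrobenius K ↥(stab (LinearMap.ker ξ) ⊓ s) := by
  let φ : subExt s.incl ξ →ₗ⁅K⁆ Module.End K X :=
    s.incl.comp ((LieHom.fst K s (Module.End K Y)).comp (subExt s.incl ξ).incl)
  have hφ : Function.Injective φ := (injective_iff_map_eq_zero _).mpr fun p hp => by
    have hp1 : p.1.1 = 0 := Subtype.ext hp
    refine Subtype.ext (Prod.ext hp1 (LinearMap.ext fun y => ?_))
    obtain ⟨x, rfl⟩ := hξ y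
    rw [← mem_subExt.mp p.2 x, hp1]
    simp
  have hrange : φ.range = stab (LinearMap.ker ξ) ⊓ s := by
    ext A
    rw [LieHom.mem_range, LieSubalgebra.mem_inf]
    constructor
    · rintro ⟨p, rfl⟩
      refine ⟨fun x hx => ?_, p.1.1.2⟩
      exact (mem_subExt.mp p.2 x).trans (by rw [LinearMap.mem_ker.mp hx, map_zero])
    · rintro ⟨hA, hAs⟩
      obtain ⟨r, hr⟩ := ξ.exists_rightInverse_of_surjective (LinearMap.range_eq_top.mpr hξ)
      refine ⟨⟨(⟨A, hAs⟩, ξ ∘ₗ A ∘ₗ r), mem_subExt.mpr fun x => ?_⟩, rfl⟩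
      have hrx : ξ (r (ξ x)) = ξ x := LinearMap.congr_fun hr (ξ x)
      have hker : ξ (A (x - r (ξ x))) = 0 :=
        hA _ (by rw [LinearMap.mem_ker, map_sub, hrx, sub_self])
      rwa [map_sub, map_sub, sub_eq_zero] at hker
  rw [← hrange, isFrobenius_range_iff hφ]

variable {U W : Submodule K V} {Q : LinearMap.BilinForm K V}

theorem isFrobenius_stab_inf_skewStab_iff_of_le (hWU : W ≤ U) :
    IsFrobenius K ↥(stab U ⊓ skewStab W Q) ↔
      IsFrobenius K (subExt (skewStab (W.comap U.subtype) (Q.restrict U)).incl U.subtype) := by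
  let s := skewStab (W.comap U.subtype) (Q.restrict U)
  let φ : subExt s.incl U.subtype →ₗ⁅K⁆ Module.End K V :=
    (LieHom.snd K s (Module.End K V)).comp (subExt s.incl U.subtype).incl
  have hφ : Function.Injective φ := (injective_iff_map_eq_zero _).mpr fun p hp => by
    have hp2 : p.1.2 = 0 := hp
    refine Subtype.ext (Prod.ext (Subtype.ext (LinearMap.ext fun u => Subtype.ext ?_)) hp2)
    exact (mem_subExt.mp p.2 u).trans (by rw [hp2]; rfl)
  have hrange : φ.range = stab U ⊓ skewStab W Q := by
    ext A
    rw [LieHom.mem_range, LieSubalgebra.mem_inf]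
    constructor
    · rintro ⟨⟨⟨⟨B, hBW, hBQ⟩, A⟩, hp⟩, rfl⟩
      have hBA (u : U) : A u = B u := (mem_subExt.mp hp u).symm
      refine ⟨fun u hu => ?_, fun w hw => ?_, fun w hw w' hw' => ?_⟩
      · exact (hBA ⟨u, hu⟩).symm ▸ Subtype.mem _
      · exact (hBA ⟨w, hWU hw⟩).symm ▸ hBW ⟨w, hWU hw⟩ hw
      · have hskew : Q (B ⟨w, hWU hw⟩) w' + Q w (B ⟨w', hWU hw'⟩) = 0 :=
          hBQ ⟨w, hWU hw⟩ hw ⟨w', hWU hw'⟩ hw'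
        rwa [← hBA, ← hBA] at hskew
    · rintro ⟨hA, hAW, hAQ⟩
      exact ⟨⟨(⟨A.restrict hA, fun w hw => hAW w hw, fun w hw w' hw' => hAQ w hw w' hw'⟩, A),
        mem_subExt.mpr fun u => rfl⟩, rfl⟩
  rw [← hrange, isFrobenius_range_iff hφ]

section Complement

variable {Z : Submodule K V}

theorem mem_stab_inf_skewStab_iff (hUZ : IsCompl U Z) (hWZ : W ≤ Z) {A : Module.End K V} :
    A ∈ stab U ⊓ skewStab W Q ↔
      ∃ α : Module.End K U, ∃ δ ∈ skewStab (W.comap Z.subtype) (Q.restrict Z),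
        ∃ φ : (Z ⧸ W.comap Z.subtype) →ₗ[K] U,
          (∀ u : U, A u = α u) ∧ ∀ z : Z, A z = φ ((W.comap Z.subtype).mkQ z) + δ z := by
  constructor
  · rintro ⟨hAU, hAW, hAQ⟩
    let δ : Module.End K Z := Z.projectionOnto U hUZ.symm ∘ₗ A ∘ₗ Z.subtype
    have hδ (w : Z) (hw : (w : V) ∈ W) : (δ w : V) = A w :=
      congrArg Subtype.val
        (Submodule.projectionOnto_apply_left hUZ.symm ⟨A w, hWZ (hAW w hw)⟩)
    refine ⟨A.restrict hAU, δ, ⟨fun w hw => ?_, fun w hw w' hw' => ?_⟩,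
      (W.comap Z.subtype).liftQ (U.projectionOnto Z hUZ ∘ₗ A ∘ₗ Z.subtype) fun w hw => ?_,
      fun u => rfl, fun z => (Submodule.projection_add_projection_eq_self hUZ (A z)).symm⟩
    · exact (congrArg (· ∈ W) (hδ w hw)).mpr (hAW w hw)
    · change Q (δ w) w' + Q w (δ w') = 0
      rw [hδ w hw, hδ w' hw', hAQ w hw w' hw']
    · exact Submodule.projectionOnto_apply_right hUZ ⟨A w, hWZ (hAW w hw)⟩
  · rintro ⟨α, δ, ⟨hδW, hδQ⟩, φ, hAU, hAZ⟩
    have hAW (w) (hw : w ∈ W) : A w = δ ⟨w, hWZ hw⟩ := by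
      have hmk : (W.comap Z.subtype).mkQ ⟨w, hWZ hw⟩ = 0 :=
        (Submodule.Quotient.mk_eq_zero _).mpr hw
      rw [hAZ ⟨w, hWZ hw⟩, hmk, map_zero, ZeroMemClass.coe_zero, zero_add]
    refine ⟨fun u hu => ?_, fun w hw => ?_, fun w hw w' hw' => ?_⟩
    · exact hAU ⟨u, hu⟩ ▸ Subtype.mem _
    · exact hAW w hw ▸ hδW ⟨w, hWZ hw⟩ hw
    · rw [hAW w hw, hAW w' hw']
      exact hδQ ⟨w, hWZ hw⟩ hw ⟨w', hWZ hw'⟩ hw'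

theorem isSemidirect_stab_inf_skewStab (hUZ : IsCompl U Z) (hWZ : W ≤ Z) :
    IsSemidirect (stab U ⊓ skewStab W Q)
      (homRep (LieHom.snd K (skewStab (W.comap Z.subtype) (Q.restrict Z)) (Module.End K U))
        ((quotRep (W.comap Z.subtype) (Q.restrict Z)).comp
          (LieHom.fst K (skewStab (W.comap Z.subtype) (Q.restrict Z)) (Module.End K U))))
      (blockDiag (U.prodEquivOfIsCompl Z hUZ).symm
        (LieHom.snd K (skewStab (W.comap Z.subtype) (Q.restrict Z)) (Module.End K U))
        ((skewStab (W.comap Z.subtype) (Q.restrict Z)).incl.comp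
          (LieHom.fst K (skewStab (W.comap Z.subtype) (Q.restrict Z)) (Module.End K U))))
      (blockUpper (U.prodEquivOfIsCompl Z hUZ).symm ∘ₗ
        LinearMap.lcomp K U (W.comap Z.subtype).mkQ) where
  mem_iff A := by
    rw [mem_stab_inf_skewStab_iff hUZ hWZ]
    constructor
    · rintro ⟨α, δ, hδ, φ, hAU, hAZ⟩
      refine ⟨(⟨δ, hδ⟩, α), φ, (blockDiag_add_blockUpper_eq_iff _).mpr
        ⟨fun u => LinearEquiv.symm_apply_eq _ |>.mpr ?_,
          fun z => LinearEquiv.symm_apply_eq _ |>.mpr ?_⟩⟩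
      · simpa using hAU u
      · simpa using hAZ z
    · rintro ⟨⟨⟨δ, hδ⟩, α⟩, φ, hA⟩
      obtain ⟨hU, hZ⟩ := (blockDiag_add_blockUpper_eq_iff _).mp hA
      refine ⟨α, δ, hδ, φ, fun u => ?_, fun z => ?_⟩
      · simpa using (LinearEquiv.symm_apply_eq _).mp (hU u)
      · simpa using (LinearEquiv.symm_apply_eq _).mp (hZ z)
  eq_zero x φ h := by
    obtain ⟨hU, hZ⟩ := (blockDiag_add_blockUpper_eq_iff _).mp h
    refine ⟨Prod.ext (Subtype.ext (LinearMap.ext fun z => ?_)) (LinearMap.ext fun u => ?_),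
      Submodule.linearMap_qext _ (LinearMap.ext fun z => ?_)⟩
    · exact (congrArg Prod.snd (hZ z)).symm.trans (by simp)
    · exact (congrArg Prod.fst (hU u)).symm.trans (by simp)
    · exact (congrArg Prod.fst (hZ z)).symm.trans (by simp)
  lie_act x φ := lie_blockDiag_blockUpper _ x _
  lie_abelian φ ψ := lie_blockUpper_blockUpper _ _ _

theorem isFrobenius_stab_inf_skewStab_iff_of_isCompl [FiniteDimensional K V] (hUZ : IsCompl U Z)
    (hWZ : W ≤ Z) :
    IsFrobenius K ↥(stab U ⊓ skewStab W Q) ↔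
      IsFrobenius K (quotExt (quotRep (W.comap Z.subtype) (Q.restrict Z))
        (LinearMap.snd K U (Z ⧸ W.comap Z.subtype))) := by
  rw [(isSemidirect_stab_inf_skewStab hUZ hWZ).isFrobenius_iff_exists_hasOpenOrbit]
  exact (isSemidirect_quotExt (quotRep (W.comap Z.subtype) (Q.restrict Z))
    (.refl K (U × (Z ⧸ W.comap Z.subtype)))).isFrobenius_iff_exists_hasOpenOrbit.symm

end Complement

end Identifications

section Codisjoint

variable {K : Type*} [Field K] {V : Type*} [AddCommGroup V] [Module K V] [FiniteDimensional K V]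
  {U W : Submodule K V} {Q : LinearMap.BilinForm K V}

theorem inf_sup_inf_orthogonal (hQ : Q.IsSymm) (hM : NondegOn Q (U ⊓ W)) :
    (U ⊓ W) ⊔ (W ⊓ Q.orthogonal (U ⊓ W)) = W := by
  have hcompl := LinearMap.BilinForm.isCompl_orthogonal_of_restrict_nondegenerate hQ.isRefl
    ((nondegOn_iff hQ).mp hM)
  rw [inf_comm W, ← sup_inf_assoc_of_le _ (inf_le_right : U ⊓ W ≤ W), hcompl.sup_eq_top, top_inf_eq]

theorem isCompl_inf_orthogonal (hQ : Q.IsSymm) (hUW : Codisjoint U W) (hM : NondegOn Q (U ⊓ W)) :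
    IsCompl U (W ⊓ Q.orthogonal (U ⊓ W)) := by
  have hcompl := LinearMap.BilinForm.isCompl_orthogonal_of_restrict_nondegenerate hQ.isRefl
    ((nondegOn_iff hQ).mp hM)
  refine ⟨disjoint_iff.mpr ?_, codisjoint_iff.mpr ?_⟩
  · rw [← inf_assoc, hcompl.inf_eq_bot]
  · calc U ⊔ (W ⊓ Q.orthogonal (U ⊓ W))
      _ = U ⊔ ((U ⊓ W) ⊔ (W ⊓ Q.orthogonal (U ⊓ W))) := by rw [← sup_assoc, sup_inf_self]
      _ = ⊤ := by rw [inf_sup_inf_orthogonal hQ hM, hUW.eq_top]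

theorem nondegOn_inf_orthogonal (hQ : Q.IsSymm) (hW : NondegOn Q W) (hM : NondegOn Q (U ⊓ W)) :
    NondegOn Q (W ⊓ Q.orthogonal (U ⊓ W)) := fun o ho hoo => by
  refine hW o ho.1 fun w hw => ?_
  rw [← inf_sup_inf_orthogonal hQ hM] at hw
  obtain ⟨m, hm, o', ho', rfl⟩ := Submodule.mem_sup.mp hw
  rw [map_add, hoo o' ho', hQ.eq, ho.2 m hm, add_zero]

theorem mem_stab_inf_skewStab_iff_of_nondegOn_inf (hQ : Q.IsSymm)
    (hM : NondegOn Q (U ⊓ W)) {A : Module.End K V} :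
    A ∈ stab U ⊓ skewStab W Q ↔
      ∃ α ∈ skewStab (W.comap U.subtype) (Q.restrict U),
        ∃ β ∈ skewAdjointLieSubalgebra (Q.restrict (W ⊓ Q.orthogonal (U ⊓ W))),
          (∀ u : U, A u = α u) ∧ ∀ o : ↥(W ⊓ Q.orthogonal (U ⊓ W)), A o = β o := by
  have hMO (m) (hm : m ∈ U ⊓ W) (o) (ho : o ∈ W ⊓ Q.orthogonal (U ⊓ W)) : Q m o = 0 := ho.2 m hm
  constructor
  · rintro ⟨hAU, hAW, hAQ⟩
    refine ⟨A.restrict hAU, ⟨fun w hw => hAW w hw, fun w hw w' hw' => hAQ w hw w' hw'⟩,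
      A.restrict fun o ho => ⟨hAW o ho.1, fun m hm => ?_⟩,
      mem_skewAdjoint_iff.mpr fun o o' => hAQ o o.2.1 o' o'.2.1, fun u => rfl, fun o => rfl⟩
    have hskew := hAQ m hm.2 o ho.1
    rwa [hMO (A m) ⟨hAU m hm.1, hAW m hm.2⟩ o ho, zero_add] at hskew
  · rintro ⟨α, ⟨hαW, hαQ⟩, β, hβ, hAU, hAO⟩
    have hAM (m) (hm : m ∈ U ⊓ W) : A m ∈ U ⊓ W := by
      rw [hAU ⟨m, hm.1⟩]
      exact ⟨Subtype.mem _, hαW ⟨m, hm.1⟩ hm.2⟩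
    have hAO' (o) (ho : o ∈ W ⊓ Q.orthogonal (U ⊓ W)) : A o ∈ W ⊓ Q.orthogonal (U ⊓ W) :=
      hAO ⟨o, ho⟩ ▸ Subtype.mem _
    have hskewM (m) (hm : m ∈ U ⊓ W) (m') (hm' : m' ∈ U ⊓ W) : Q (A m) m' + Q m (A m') = 0 := by
      rw [hAU ⟨m, hm.1⟩, hAU ⟨m', hm'.1⟩]
      exact hαQ ⟨m, hm.1⟩ hm.2 ⟨m', hm'.1⟩ hm'.2
    have hskewO (o) (ho : o ∈ W ⊓ Q.orthogonal (U ⊓ W)) (o')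
        (ho' : o' ∈ W ⊓ Q.orthogonal (U ⊓ W)) : Q (A o) o' + Q o (A o') = 0 := by
      rw [hAO ⟨o, ho⟩, hAO ⟨o', ho'⟩]
      exact mem_skewAdjoint_iff.mp hβ ⟨o, ho⟩ ⟨o', ho'⟩
    refine ⟨fun u hu => hAU ⟨u, hu⟩ ▸ Subtype.mem _, fun w hw => ?_, fun w hw w' hw' => ?_⟩ <;>
      rw [← inf_sup_inf_orthogonal hQ hM] at hw <;>
      obtain ⟨m, hm, o, ho, rfl⟩ := Submodule.mem_sup.mp hw
    · rw [map_add]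
      exact W.add_mem (hAM m hm).2 (hAO' o ho).1
    · rw [← inf_sup_inf_orthogonal hQ hM] at hw'
      obtain ⟨m', hm', o', ho', rfl⟩ := Submodule.mem_sup.mp hw'
      simp only [map_add, LinearMap.add_apply, hMO _ (hAM m hm) o' ho', hMO m hm _ (hAO' o' ho'),
        hQ.eq o (A m'), hQ.eq (A o) m', hMO _ (hAM m' hm') o ho, hMO m' hm' _ (hAO' o ho)]
      linear_combination hskewM m hm m' hm' + hskewO o ho o' ho'

theorem isFrobenius_stab_inf_skewStab_iff_and (hQ : Q.IsSymm) (hUW : Codisjoint U W)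
    (hM : NondegOn Q (U ⊓ W)) :
    IsFrobenius K ↥(stab U ⊓ skewStab W Q) ↔
      IsFrobenius K (skewStab (W.comap U.subtype) (Q.restrict U)) ∧
        IsFrobenius K (skewAdjointLieSubalgebra (Q.restrict (W ⊓ Q.orthogonal (U ⊓ W)))) := by
  have hUO := isCompl_inf_orthogonal hQ hUW hM
  let s := skewStab (W.comap U.subtype) (Q.restrict U)
  let t := skewAdjointLieSubalgebra (Q.restrict (W ⊓ Q.orthogonal (U ⊓ W)))
  let φ : s × t →ₗ⁅K⁆ Module.End K V := blockDiag (U.prodEquivOfIsCompl _ hUO).symm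
    (s.incl.comp (LieHom.fst K s t)) (t.incl.comp (LieHom.snd K s t))
  have hφ (x : s × t) (A : Module.End K V) : φ x = A ↔ (∀ u : U, A u = x.1.1 u) ∧
      ∀ o : ↥(W ⊓ Q.orthogonal (U ⊓ W)), A o = x.2.1 o := by
    refine (blockDiag_eq_iff _).trans (and_congr (forall_congr' fun u => ?_)
      (forall_congr' fun o => ?_)) <;> rw [LinearEquiv.symm_apply_eq] <;> simp
  have hinj : Function.Injective φ := (injective_iff_map_eq_zero _).mpr fun x hx => by
    obtain ⟨hU, hO⟩ := (hφ x 0).mp hx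
    exact Prod.ext (Subtype.ext (LinearMap.ext fun u => Subtype.ext (hU u).symm))
      (Subtype.ext (LinearMap.ext fun o => Subtype.ext (hO o).symm))
  have hrange : φ.range = stab U ⊓ skewStab W Q := by
    ext A
    rw [mem_stab_inf_skewStab_iff_of_nondegOn_inf hQ hM, LieHom.mem_range]
    simp only [hφ, Prod.exists, Subtype.exists, exists_prop]
    exact ⟨fun ⟨α, hα, β, hβ, hA⟩ => ⟨α, hα, β, hβ, hA⟩,
      fun ⟨α, hα, β, hβ, hA⟩ => ⟨α, hα, β, hβ, hA⟩⟩
  rw [← isFrobenius_prod_iff, ← isFrobenius_range_iff hinj, hrange]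

theorem isFrobenius_stab_inf_skewStab_iff_of_codisjoint [NeZero (2 : K)] (hQ : Q.IsSymm)
    (hUW : Codisjoint U W) (hW : NondegOn Q W) (hM : NondegOn Q (U ⊓ W)) :
    IsFrobenius K ↥(stab U ⊓ skewStab W Q) ↔
      IsFrobenius K (skewStab (W.comap U.subtype) (Q.restrict U)) ∧
        Module.finrank K V ≤ Module.finrank K U + 1 := by
  have hdim := Submodule.finrank_add_eq_of_isCompl (isCompl_inf_orthogonal hQ hUW hM)
  have hO := (nondegOn_iff hQ).mp (nondegOn_inf_orthogonal hQ hW hM)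
  rw [isFrobenius_stab_inf_skewStab_iff_and hQ hUW hM,
    isFrobenius_skewAdjoint_iff (hQ.restrict _) hO]
  refine and_congr_right fun _ => ?_
  omega

end Codisjoint

section Openness

variable {K : Type*} [Field K] {X Y Z : Type*} [AddCommGroup X] [Module K X] [AddCommGroup Y]
  [Module K Y] [AddCommGroup Z] [Module K Z]

theorem injective_or_surjective_of_forall_comp_eq_zero (ξ : X →ₗ[K] Y)
    (h : ∀ φ : Y →ₗ[K] X, φ ∘ₗ ξ = 0 → ξ ∘ₗ φ = 0 → φ = 0) :
    Function.Injective ξ ∨ Function.Surjective ξ := by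
  rw [← LinearMap.ker_eq_bot, ← LinearMap.range_eq_top]
  by_contra! hξ
  obtain ⟨x, hx, hx0⟩ := Submodule.exists_mem_ne_zero_of_ne_bot hξ.1
  obtain ⟨l, hl0, hl⟩ := (LinearMap.range ξ).exists_le_ker_of_lt_top hξ.2.lt_top
  have hlξ (y : X) : l (ξ y) = 0 := hl ⟨y, rfl⟩
  have hφ : l.smulRight x = 0 := h _ (LinearMap.ext fun y => by simp [hlξ])
    (LinearMap.ext fun y => by simp [LinearMap.mem_ker.mp hx])
  exact (LinearMap.smulRight_apply_eq_zero_iff.mp hφ).elim hl0 hx0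

theorem isFrobenius_quotExt_iff_of_surjective {L : Type*} [LieRing L] [LieAlgebra K L]
    [FiniteDimensional K X] [FiniteDimensional K Z] {ρ : L →ₗ⁅K⁆ Module.End K Z}
    (hρ : Function.Surjective ρ) {π : X →ₗ[K] Z} (hπ : Function.Surjective π) :
    IsFrobenius K (quotExt ρ π) ↔ ∃ ξ : LinearMap.ker π →ₗ[K] Z,
      (Function.Injective ξ ∨ Function.Surjective ξ) ∧ IsFrobenius K (quotExt ρ ξ) := by
  rw [isFrobenius_quotExt_iff ρ hπ]
  refine exists_congr fun ξ => and_congr_left fun _ => ⟨fun h => ?_, fun h φ hφ hρφ => ?_⟩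
  · refine injective_or_surjective_of_forall_comp_eq_zero ξ fun φ hφ hξ => h φ hφ fun x => ?_
    change LinearMap.trace K Z ((ξ ∘ₗ φ) ∘ₗ ρ x) = 0
    rw [hξ, LinearMap.zero_comp, map_zero]
  · rcases h with h | h
    · have htr : traceDual (ξ ∘ₗ φ) = 0 := LinearMap.ext fun B => by
        obtain ⟨x, rfl⟩ := hρ B
        exact hρφ x
      have hξφ : ξ ∘ₗ φ = 0 := traceDual_injective (htr.trans (map_zero _).symm)
      exact (LinearMap.cancel_left h).mp (hξφ.trans (LinearMap.comp_zero ξ).symm)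
    · exact (LinearMap.cancel_right h).mp (hφ.trans (LinearMap.zero_comp ξ).symm)

variable {W N : Submodule K X} {Q : LinearMap.BilinForm K X}

theorem skewPair_mem_skewStab (hQ : Q.IsSymm) {x y : X} (hx : x ∈ W) (hy : y ∈ W) :
    skewPair Q x y ∈ skewStab W Q :=
  ⟨fun _ _ => W.sub_mem (W.smul_mem _ hy) (W.smul_mem _ hx), fun w _ w' _ =>
    mem_skewAdjoint_iff.mp (skewPair_mem_skewAdjoint hQ x y) w w'⟩

theorem smulRight_mem_skewStab {l : Module.Dual K X} (hl : W ≤ LinearMap.ker l) (x : X) :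
    l.smulRight x ∈ skewStab W Q := by
  have hzero (w) (hw : w ∈ W) : l.smulRight x w = 0 := by
    rw [LinearMap.smulRight_apply, LinearMap.mem_ker.mp (hl hw), zero_smul]
  refine ⟨fun w hw => (hzero w hw).symm ▸ W.zero_mem, fun w hw w' hw' => ?_⟩
  rw [hzero w hw, hzero w' hw', map_zero, map_zero, LinearMap.zero_apply, add_zero]

section Annihilator

variable [FiniteDimensional K X] {ψ : Module.End K X}

theorem apply_mem_of_forall_traceDual_eq_zero (hψ : ∀ A ∈ skewStab W Q, traceDual ψ A = 0)
    (v : X) : ψ v ∈ W := by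
  by_contra hv
  obtain ⟨l, hlv, hl⟩ := Submodule.exists_le_ker_of_notMem hv
  exact hlv ((traceDual_smulRight ψ l v).symm.trans (hψ _ (smulRight_mem_skewStab hl v)))

theorem apply_comm_of_forall_traceDual_eq_zero (hQ : Q.IsSymm)
    (hψ : ∀ A ∈ skewStab W Q, traceDual ψ A = 0) {w w' : X} (hw : w ∈ W) (hw' : w' ∈ W) :
    Q w (ψ w') = Q w' (ψ w) := by
  have htr := hψ _ (skewPair_mem_skewStab hQ hw hw')
  rwa [skewPair, map_sub, traceDual_smulRight, traceDual_smulRight, sub_eq_zero] at htr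

end Annihilator

theorem eq_zero_of_codisjoint_of_nondegOn_inf (hQ : Q.IsSymm) (hNW : Codisjoint N W)
    (hM : NondegOn Q (N ⊓ W)) {ψ : Module.End K X} (hN : ∀ v ∈ N, ψ v = 0)
    (hψ : ∀ v, ψ v ∈ N ⊓ W) (hcomm : ∀ w ∈ W, ∀ w' ∈ W, Q w (ψ w') = Q w' (ψ w)) : ψ = 0 := by
  have hW (w) (hw : w ∈ W) : ψ w = 0 := hM _ (hψ w) fun m hm => by
    rw [hQ.eq, hcomm m hm.2 w hw, hN m hm.1, map_zero]
  ext v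
  obtain ⟨n, hn, w, hw, rfl⟩ := Submodule.mem_sup.mp (hNW.eq_top ▸ Submodule.mem_top (x := v))
  rw [map_add, hN n hn, hW w hw, add_zero, LinearMap.zero_apply]

theorem traceDual_comp (ξ : X →ₗ[K] Y) (φ : Y →ₗ[K] X) (A : Module.End K X)
    [FiniteDimensional K X] [FiniteDimensional K Y] :
    traceDual ξ (A ∘ₗ φ) = traceDual (φ ∘ₗ ξ) A :=
  (LinearMap.trace_comp_comm' (ξ ∘ₗ A) φ).symm

section Surjective

variable [FiniteDimensional K Y] {ξ : X →ₗ[K] Y}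

theorem eq_zero_of_forall_apply_eq_zero {s : LieSubalgebra K (Module.End K X)}
    (hopen : ∀ φ : Y →ₗ[K] X, ξ ∘ₗ φ = 0 → (∀ A : s, traceDual ξ (s.incl A ∘ₗ φ) = 0) → φ = 0)
    {l : Module.Dual K Y} {m : X} (hm : m ∈ LinearMap.ker ξ) (hm0 : m ≠ 0)
    (hl : ∀ A ∈ s, l (ξ (A m)) = 0) : l = 0 := by
  have hφ : l.smulRight m = 0 := by
    refine hopen _ (LinearMap.ext fun y => ?_) fun A => ?_
    · simp [LinearMap.mem_ker.mp hm]
    · have hcomp : s.incl A ∘ₗ l.smulRight m = l.smulRight ((A : Module.End K X) m) := by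
        ext; simp
      rw [hcomp, traceDual_smulRight, hl A A.2]
  exact (LinearMap.smulRight_apply_eq_zero_iff.mp hφ).resolve_right hm0

theorem codisjoint_ker_of_forall_comp_eq_zero (hξ : Function.Surjective ξ)
    (hopen : ∀ φ : Y →ₗ[K] X, ξ ∘ₗ φ = 0 →
      (∀ A, traceDual ξ ((skewStab W Q).incl A ∘ₗ φ) = 0) → φ = 0)
    (hNW : ¬ Disjoint (LinearMap.ker ξ) W) : Codisjoint (LinearMap.ker ξ) W := by
  rw [disjoint_iff] at hNW
  obtain ⟨m, hm, hm0⟩ := Submodule.exists_mem_ne_zero_of_ne_bot hNW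
  rw [codisjoint_iff, sup_comm, ← LinearMap.map_eq_top_iff (LinearMap.range_eq_top.mpr hξ)]
  by_contra htop
  obtain ⟨l, hl0, hl⟩ := (W.map ξ).exists_le_ker_of_lt_top (Ne.lt_top htop)
  exact hl0 (eq_zero_of_forall_apply_eq_zero hopen hm.1 hm0 fun A hA => hl ⟨A m, hA.1 m hm.2, rfl⟩)

theorem nondegOn_ker_inf_of_forall_comp_eq_zero [NeZero (2 : K)] (hQ : Q.IsSymm)
    (hW : NondegOn Q W)
    (hopen : ∀ φ : Y →ₗ[K] X, ξ ∘ₗ φ = 0 →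
      (∀ A, traceDual ξ ((skewStab W Q).incl A ∘ₗ φ) = 0) → φ = 0) :
    NondegOn Q (LinearMap.ker ξ ⊓ W) := by
  intro m hm hmm
  by_contra hm0
  obtain ⟨l, hl⟩ : (Q m).domRestrict W ∈ LinearMap.range (ξ.domRestrict W).dualMap := by
    rw [LinearMap.range_dualMap_eq_dualAnnihilator_ker, Submodule.mem_dualAnnihilator]
    exact fun w hw => hmm w ⟨hw, w.2⟩
  have hlξ (w) (hw : w ∈ W) : l (ξ w) = Q m w := LinearMap.congr_fun hl ⟨w, hw⟩
  have hl0 : l = 0 := eq_zero_of_forall_apply_eq_zero hopen hm.1 hm0 fun A hA => by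
    have hskew := hA.2 m hm.2 m hm.2
    rw [hQ.eq, ← two_mul] at hskew
    rw [hlξ _ (hA.1 m hm.2), (mul_eq_zero.mp hskew).resolve_left two_ne_zero]
  exact hm0 (hW m hm.2 fun w hw => by rw [← hlξ w hw, hl0, LinearMap.zero_apply])

theorem forall_comp_eq_zero_iff_of_surjective [FiniteDimensional K X] [NeZero (2 : K)]
    (hQ : Q.IsSymm) (hW : NondegOn Q W) (hξ : Function.Surjective ξ) :
    (∀ φ : Y →ₗ[K] X, ξ ∘ₗ φ = 0 → (∀ A, traceDual ξ ((skewStab W Q).incl A ∘ₗ φ) = 0) → φ = 0) ↔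
      Disjoint (LinearMap.ker ξ) W ∨
        Codisjoint (LinearMap.ker ξ) W ∧ NondegOn Q (LinearMap.ker ξ ⊓ W) := by
  constructor
  · exact fun hopen => or_iff_not_imp_left.mpr fun hNW =>
      ⟨codisjoint_ker_of_forall_comp_eq_zero hξ hopen hNW,
        nondegOn_ker_inf_of_forall_comp_eq_zero hQ hW hopen⟩
  · intro h φ hξφ hφ
    have htr (A) (hA : A ∈ skewStab W Q) : traceDual (φ ∘ₗ ξ) A = 0 :=
      (traceDual_comp ξ φ A).symm.trans (hφ ⟨A, hA⟩)
    have hmem (v : X) : (φ ∘ₗ ξ) v ∈ LinearMap.ker ξ ⊓ W :=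
      ⟨LinearMap.congr_fun hξφ (ξ v), apply_mem_of_forall_traceDual_eq_zero htr v⟩
    refine (LinearMap.cancel_right hξ).mp (Eq.trans ?_ (LinearMap.zero_comp ξ).symm)
    rcases h with hdisj | ⟨hcod, hM⟩
    · exact LinearMap.ext fun v => Submodule.disjoint_def.mp hdisj _ (hmem v).1 (hmem v).2
    · refine eq_zero_of_codisjoint_of_nondegOn_inf hQ hcod hM (fun v hv => ?_) hmem
        fun w hw w' hw' => apply_comm_of_forall_traceDual_eq_zero hQ htr hw hw'
      rw [LinearMap.comp_apply, LinearMap.mem_ker.mp hv, map_zero]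

end Surjective

theorem isFrobenius_subExt_skewStab_iff [FiniteDimensional K X] [FiniteDimensional K Y]
    [NeZero (2 : K)] (hQ : Q.IsSymm) (hW : NondegOn Q W) {i : X →ₗ[K] Y}
    (hi : Function.Injective i) :
    IsFrobenius K (subExt (skewStab W Q).incl i) ↔ ∃ ξ : X →ₗ[K] Y ⧸ LinearMap.range i,
      (Function.Injective ξ ∨ Function.Surjective ξ ∧ (Disjoint (LinearMap.ker ξ) W ∨
        Codisjoint (LinearMap.ker ξ) W ∧ NondegOn Q (LinearMap.ker ξ ⊓ W))) ∧
        IsFrobenius K (subExt (skewStab W Q).incl ξ) := by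
  rw [isFrobenius_subExt_iff _ hi]
  refine exists_congr fun ξ => and_congr_left fun _ => ⟨fun hopen => ?_, ?_⟩
  · have hξ := injective_or_surjective_of_forall_comp_eq_zero ξ fun φ hφξ hξφ =>
      hopen φ hξφ fun A => by rw [traceDual_comp, hφξ, map_zero, LinearMap.zero_apply]
    exact hξ.imp_right fun hsurj =>
      ⟨hsurj, (forall_comp_eq_zero_iff_of_surjective hQ hW hsurj).mp hopen⟩
  · rintro (hinj | ⟨hsurj, h⟩)
    · exact fun φ hξφ _ => (LinearMap.cancel_left hinj).mp
        (hξφ.trans (LinearMap.comp_zero ξ).symm)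
    · exact (forall_comp_eq_zero_iff_of_surjective hQ hW hsurj).mpr h

end Openness

section Existence

variable {K : Type*} [Field K] {X Y : Type*} [AddCommGroup X] [Module K X] [AddCommGroup Y]
  [Module K Y] {W : Submodule K X} {Q : LinearMap.BilinForm K X}

theorem exists_mem_self_ne_zero [NeZero (2 : K)] (hQ : Q.IsSymm) (hW : NondegOn Q W)
    (hW0 : W ≠ ⊥) : ∃ w ∈ W, Q w w ≠ 0 := by
  obtain ⟨w, hw, hw0⟩ := Submodule.exists_mem_ne_zero_of_ne_bot hW0
  have : Invertible (2 : K) := invertibleOfNonzero two_ne_zero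
  obtain ⟨v, hv⟩ := LinearMap.BilinForm.exists_bilinForm_self_ne_zero (B := Q.restrict W)
    (fun h => hw0 (hW w hw fun w' hw' =>
      LinearMap.congr_fun (LinearMap.congr_fun h ⟨w, hw⟩) ⟨w', hw'⟩))
    (LinearMap.BilinForm.isSymm_iff.mp (hQ.restrict W))
  exact ⟨v, v.2, hv⟩

theorem nondegOn_ker_inf (hQ : Q.IsSymm) (hW : NondegOn Q W) {w : X} (hw : w ∈ W)
    (hww : Q w w ≠ 0) : NondegOn Q (LinearMap.ker (Q w) ⊓ W) := fun m hm hmm => by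
  refine hW m hm.2 fun w' hw' => ?_
  have hproj : w' - (Q w w' / Q w w) • w ∈ LinearMap.ker (Q w) ⊓ W := by
    refine ⟨?_, W.sub_mem hw' (W.smul_mem _ hw)⟩
    rw [SetLike.mem_coe, LinearMap.mem_ker, map_sub, map_smul, smul_eq_mul,
      div_mul_cancel₀ _ hww, sub_self]
  have hmw : Q m w = 0 := (hQ.eq m w).trans hm.1
  simpa [hmw] using hmm _ hproj

theorem exists_surjective_codisjoint_nondegOn [NeZero (2 : K)] [FiniteDimensional K Y]
    (hQ : Q.IsSymm) (hW : NondegOn Q W) (hW0 : W ≠ ⊥) (hY : Module.finrank K Y ≤ 1) :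
    ∃ ξ : X →ₗ[K] Y, Function.Surjective ξ ∧ Codisjoint (LinearMap.ker ξ) W ∧
      NondegOn Q (LinearMap.ker ξ ⊓ W) := by
  rcases Nat.le_one_iff_eq_zero_or_eq_one.mp hY with hY | hY
  · have : Subsingleton Y := Module.finrank_zero_iff.mp hY
    exact ⟨0, Function.surjective_to_subsingleton _, by simp, by simpa using hW⟩
  · obtain ⟨w, hw, hww⟩ := exists_mem_self_ne_zero hQ hW hW0
    let e : K ≃ₗ[K] Y := LinearEquiv.ofFinrankEq K Y ((Module.finrank_self K).trans hY.symm)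
    refine ⟨e.toLinearMap ∘ₗ Q w, e.surjective.comp (LinearMap.surjective fun h => hww ?_), ?_, ?_⟩
    · rw [h, LinearMap.zero_apply]
    · rw [LinearEquiv.ker_comp, codisjoint_comm]
      refine (codisjoint_iff.mpr ((Q w).span_singleton_sup_ker_eq_top hww)).mono_left ?_
      rwa [Submodule.span_singleton_le_iff_mem]
    · rw [LinearEquiv.ker_comp]
      exact nondegOn_ker_inf hQ hW hw hww

theorem exists_surjective_disjoint [FiniteDimensional K X] [FiniteDimensional K Y]
    (W : Submodule K X) (hWY : Module.finrank K W ≤ Module.finrank K Y)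
    (hYX : Module.finrank K Y ≤ Module.finrank K X) :
    ∃ ξ : X →ₗ[K] Y, Function.Surjective ξ ∧ Disjoint (LinearMap.ker ξ) W := by
  obtain ⟨D, hWD⟩ := W.exists_isCompl
  have hfinD := Submodule.finrank_add_eq_of_isCompl hWD
  obtain ⟨j, hj⟩ := finrank_le_iff_exists_linearMap (R := K)
    (M := Fin (Module.finrank K X - Module.finrank K Y) → K) (M' := D) |>.mp
    (by rw [Module.finrank_fin_fun]; omega)
  let N := LinearMap.range (D.subtype ∘ₗ j)
  have hND : N ≤ D := (LinearMap.range_comp_le_range j D.subtype).trans D.range_subtype.le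
  have hfinN : Module.finrank K N = Module.finrank K X - Module.finrank K Y := by
    rw [LinearMap.finrank_range_of_inj (Subtype.val_injective.comp hj), Module.finrank_fin_fun]
  have hfinQ := N.finrank_quotient_add_finrank
  let e : (X ⧸ N) ≃ₗ[K] Y := LinearEquiv.ofFinrankEq _ _ (by omega)
  refine ⟨e.toLinearMap ∘ₗ N.mkQ, e.surjective.comp N.mkQ_surjective, ?_⟩
  rw [LinearEquiv.ker_comp, Submodule.ker_mkQ]
  exact hWD.symm.disjoint.mono_left hND

end Existence

section Dimensions

variable {K : Type*} [Field K] {V X : Type*} [AddCommGroup V] [Module K V] [AddCommGroup X]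
  [Module K X]

theorem exists_and_iff_of_forall {α : Type*} {p q : α → Prop} {P : Prop}
    (hiff : ∀ a, p a → (q a ↔ P)) (hex : P → ∃ a, p a) : (∃ a, p a ∧ q a) ↔ P :=
  ⟨fun ⟨a, hp, hq⟩ => (hiff a hp).mp hq,
    fun hP => (hex hP).imp fun a hp => ⟨hp, (hiff a hp).mpr hP⟩⟩

theorem finrank_comap_subtype (U W : Submodule K V) :
    Module.finrank K (W.comap U.subtype) = Module.finrank K ↥(U ⊓ W) := by
  rw [← Submodule.map_comap_subtype, Submodule.finrank_map_subtype_eq]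

variable [FiniteDimensional K V]

theorem finrank_add_finrank_ker_of_surjective {π : V →ₗ[K] X} (hπ : Function.Surjective π) :
    Module.finrank K X + Module.finrank K (LinearMap.ker π) = Module.finrank K V := by
  rw [← π.finrank_range_add_finrank_ker, LinearMap.range_eq_top.mpr hπ, finrank_top]

theorem finrank_comap_mkQ (W : Submodule K V) (Y : Submodule K (V ⧸ W)) :
    Module.finrank K (Y.comap W.mkQ) = Module.finrank K Y + Module.finrank K W := by
  have hcomap := finrank_add_finrank_ker_of_surjective (π := Y.mkQ ∘ₗ W.mkQ)
    (Y.mkQ_surjective.comp W.mkQ_surjective)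
  rw [LinearMap.ker_comp, Submodule.ker_mkQ] at hcomap
  have hY := Y.finrank_quotient_add_finrank
  have hW := W.finrank_quotient_add_finrank
  omega

theorem injective_of_surjective_of_finrank_le [FiniteDimensional K X] {ξ : V →ₗ[K] X}
    (hξ : Function.Surjective ξ) (hVX : Module.finrank K V ≤ Module.finrank K X) :
    Function.Injective ξ :=
  (LinearMap.injective_iff_surjective_of_finrank_eq_finrank
    (hVX.antisymm (LinearMap.finrank_le_finrank_of_surjective hξ))).mpr hξ

theorem disjoint_of_codisjoint_of_finrank_add_le {U W : Submodule K V} (hUW : Codisjoint U W)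
    (hle : Module.finrank K U + Module.finrank K W ≤ Module.finrank K V) : Disjoint U W := by
  have hdim := Submodule.finrank_sup_add_finrank_inf_eq U W
  rw [hUW.eq_top, finrank_top] at hdim
  exact disjoint_iff.mpr (Submodule.finrank_eq_zero.mp (by omega))

end Dimensions

universe u

section SkewStab

variable {K : Type*} [Field K] [NeZero (2 : K)] {V X : Type u} [AddCommGroup V] [Module K V]
  [FiniteDimensional K V] [AddCommGroup X] [Module K X] [FiniteDimensional K X]

theorem isFrobenius_subExt_skewStab_top_iff {Q : LinearMap.BilinForm K X} (hQ : Q.IsSymm)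
    (hn : NondegOn Q ⊤) (hX : 0 < Module.finrank K X) (d : ℕ) :
    ∀ {V : Type u} [AddCommGroup V] [Module K V] [FiniteDimensional K V] {i : X →ₗ[K] V},
      Function.Injective i → Module.finrank K V = d →
      (IsFrobenius K (subExt (skewStab ⊤ Q).incl i) ↔
        Module.finrank K X = 1 ∨ (Module.finrank K X = 2 ∧ Odd d)) := by
  induction d using Nat.strong_induction_on with
  | _ d ih =>
    intro V _ _ _ i hi hd
    have hcodim := (LinearMap.range i).finrank_quotient_add_finrank
    rw [LinearMap.finrank_range_of_inj hi, hd] at hcodim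
    rw [isFrobenius_subExt_skewStab_iff hQ hn hi]
    by_cases hle : Module.finrank K X ≤ Module.finrank K (V ⧸ LinearMap.range i)
    · refine exists_and_iff_of_forall (fun ξ hξ => ?_) fun _ =>
        (finrank_le_iff_exists_linearMap.mp hle).imp fun ξ hξ => Or.inl hξ
      have hinj : Function.Injective ξ :=
        hξ.elim id fun h => injective_of_surjective_of_finrank_le h.1 hle
      rw [ih _ (by omega) hinj rfl]
      refine or_congr_right (and_congr_right fun h2 => ?_)
      rw [Nat.odd_iff, Nat.odd_iff]
      omega
    · refine exists_and_iff_of_forall (fun ξ hξ => ?_) fun h => ?_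
      · have hninj : ¬ Function.Injective ξ := fun h =>
          hle (LinearMap.finrank_le_finrank_of_injective h)
        obtain ⟨hsurj, hdisj | ⟨hcodisj, hnondeg⟩⟩ := hξ.resolve_left hninj
        · exact absurd (LinearMap.ker_eq_bot.mp (disjoint_top.mp hdisj)) hninj
        have hker := finrank_add_finrank_ker_of_surjective hsurj
        have hnd : (Q.restrict (LinearMap.ker ξ)).Nondegenerate :=
          (nondegOn_iff hQ).mp (inf_top_eq (LinearMap.ker ξ) ▸ hnondeg)
        rw [isFrobenius_subExt_incl_iff_of_surjective _ hsurj,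
          isFrobenius_stab_inf_skewStab_iff_of_codisjoint hQ hcodisj hn hnondeg,
          Submodule.comap_top, skewStab_top, isFrobenius_skewAdjoint_iff (hQ.restrict _) hnd,
          Nat.odd_iff]
        omega
      · have hX0 : (⊤ : Submodule K X) ≠ ⊥ := fun h0 => by
          rw [← finrank_top K X, h0, finrank_bot] at hX
          exact hX.false
        exact (exists_surjective_codisjoint_nondegOn hQ hn hX0 (by omega)).imp
          fun ξ h => Or.inr ⟨h.1, Or.inr h.2⟩

theorem isFrobenius_skewStab_iff {W : Submodule K V} {Q : LinearMap.BilinForm K V}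
    (hQ : Q.IsSymm) (hW : NondegOn Q W) (hr : 0 < Module.finrank K W) :
    IsFrobenius K (skewStab W Q) ↔
      Module.finrank K W = 1 ∨ (Module.finrank K W = 2 ∧ Odd (Module.finrank K V)) := by
  have hstab : stab W ⊓ skewStab W Q = skewStab W Q := inf_eq_right.mpr fun _ hA => hA.1
  have hnd : NondegOn (Q.restrict W) (W.comap W.subtype) :=
    nondegOn_comap_subtype ((inf_idem W).symm ▸ hW)
  rw [← hstab, isFrobenius_stab_inf_skewStab_iff_of_le le_rfl, Submodule.comap_subtype_self]
  rw [Submodule.comap_subtype_self] at hnd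
  exact isFrobenius_subExt_skewStab_top_iff (hQ.restrict W) hnd hr _ W.subtype_injective rfl

end SkewStab

section Criterion

/-- The numerical criterion for an endomorphism algebra preserving a nondegenerate form on a
subspace of dimension `r` to be Frobenius, where `g` is a greatest common divisor built from the
remaining dimensions. -/
def IsFrobeniusPair (r g : ℕ) : Prop := (r = 1 ∧ g = 1) ∨ (r = 2 ∧ g = 1) ∨ (r = 3 ∧ g = 2)

theorem isFrobeniusPair_gcd_sub_iff_of_lt {n b r : ℕ} (hbr : b < r) (hbn : b ≤ n) :
    IsFrobeniusPair r (Int.gcd n (b - r)) ↔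
      (r - b = 1 ∨ (r - b = 2 ∧ Odd (n - b))) ∧ b ≤ 1 := by
  have hgcd : Int.gcd n (b - r) = Nat.gcd n (r - b) := by
    rw [← Int.gcd_natCast_natCast, ← Int.gcd_neg]
    congr 1
    omega
  have hgcd2 : Nat.gcd n 2 = if n % 2 = 0 then 2 else 1 := by
    split_ifs with h
    · exact Nat.gcd_eq_right (Nat.dvd_of_mod_eq_zero h)
    · exact Nat.coprime_two_right.mpr (Nat.odd_iff.mpr (by omega))
  have hgcd3 : Nat.gcd n 3 ≠ 2 := fun h => by
    have : 2 ∣ 3 := h ▸ Nat.gcd_dvd_right n 3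
    omega
  rw [hgcd, IsFrobeniusPair, Nat.odd_iff]
  by_cases hr : r ≤ 3
  · interval_cases r <;> interval_cases b <;> (simp_all; try omega)
  · omega

/-- The criterion for the algebras `quotExt (quotRep W Q) π` with `π : V → Z ⧸ W` surjective and
`dim (ker π) + dim Z = n`. -/
def QuotCriterion (K : Type*) [Field K] (n : ℕ) : Prop :=
  ∀ {Z V : Type u} [AddCommGroup Z] [Module K Z] [FiniteDimensional K Z] [AddCommGroup V]
    [Module K V] [FiniteDimensional K V] {W : Submodule K Z} {Q : LinearMap.BilinForm K Z}
    {π : V →ₗ[K] Z ⧸ W}, Q.IsSymm → NondegOn Q W → 0 < Module.finrank K W →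
    Function.Surjective π → Module.finrank K (LinearMap.ker π) + Module.finrank K Z = n →
    (IsFrobenius K (quotExt (quotRep W Q) π) ↔ IsFrobeniusPair (Module.finrank K W)
      (Int.gcd n (Module.finrank K Z - Module.finrank K W)))

/-- The criterion for the algebras `subExt (skewStab W Q).incl i` with `i : X → V` injective and
`dim V = d`. -/
def SubCriterion (K : Type*) [Field K] (d : ℕ) : Prop :=
  ∀ {X V : Type u} [AddCommGroup X] [Module K X] [FiniteDimensional K X] [AddCommGroup V]
    [Module K V] [FiniteDimensional K V] {W : Submodule K X} {Q : LinearMap.BilinForm K X}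
    {i : X →ₗ[K] V}, Q.IsSymm → NondegOn Q W → 0 < Module.finrank K W →
    Function.Injective i → Module.finrank K V = d →
    (IsFrobenius K (subExt (skewStab W Q).incl i) ↔ IsFrobeniusPair (Module.finrank K W)
      (Int.gcd (Module.finrank K X) (d - Module.finrank K X - Module.finrank K W)))

variable {K : Type*} [Field K] {V : Type u} [AddCommGroup V] [Module K V] [FiniteDimensional K V]
  {U W : Submodule K V} {Q : LinearMap.BilinForm K V}

theorem isFrobenius_quotExt_iff_of_subsingleton {L : Type*} [LieRing L] [LieAlgebra K L]
    {Y : Type*} [AddCommGroup Y] [Module K Y] [Subsingleton Y]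
    (ρ : L →ₗ⁅K⁆ Module.End K Y) (π : V →ₗ[K] Y) :
    IsFrobenius K (quotExt ρ π) ↔ IsFrobenius K L ∧ Module.finrank K V = 0 := by
  have htop : quotExt ρ π = ⊤ := eq_top_iff.mpr fun _ _ => mem_quotExt.mpr fun _ =>
    Subsingleton.elim _ _
  rw [htop, isFrobenius_congr LieSubalgebra.topEquiv, isFrobenius_prod_iff, isFrobenius_end_iff,
    Module.finrank_zero_iff]

theorem QuotCriterion.isFrobenius_stab_inf_skewStab_iff {d b : ℕ}
    (h : QuotCriterion.{u} K d) (hQ : Q.IsSymm) (hW : NondegOn Q W)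
    (hr : 0 < Module.finrank K W) (hUW : Disjoint U W) (hd : Module.finrank K V = d)
    (hb : Module.finrank K U + b = d) :
    IsFrobenius K ↥(stab U ⊓ skewStab W Q) ↔
      IsFrobeniusPair (Module.finrank K W) (Int.gcd d (b - Module.finrank K W)) := by
  obtain ⟨Z, hWZ, hZU⟩ := hUW.symm.exists_isCompl
  have hdim := Submodule.finrank_add_eq_of_isCompl hZU
  have hker := finrank_add_finrank_ker_of_surjective
    (LinearMap.snd_surjective (R := K) (M := U) (M₂ := Z ⧸ W.comap Z.subtype))
  rw [Module.finrank_prod] at hker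
  have hZW : Z ⊓ W = W := inf_eq_right.mpr hWZ
  have hrank : Module.finrank K (W.comap Z.subtype) = Module.finrank K W := by
    rw [finrank_comap_subtype, hZW]
  have hZ : Module.finrank K Z = b := by omega
  rw [isFrobenius_stab_inf_skewStab_iff_of_isCompl hZU.symm hWZ,
    h (hQ.restrict Z) (nondegOn_comap_subtype (hZW.symm ▸ hW)) (hrank ▸ hr)
      LinearMap.snd_surjective (by omega), hrank, hZ]

theorem SubCriterion.isFrobenius_stab_inf_skewStab_iff {d : ℕ}
    (h : SubCriterion.{u} K d) (hQ : Q.IsSymm) (hW : NondegOn Q W)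
    (hr : 0 < Module.finrank K W) (hWU : W ≤ U) (hd : Module.finrank K V = d) :
    IsFrobenius K ↥(stab U ⊓ skewStab W Q) ↔ IsFrobeniusPair (Module.finrank K W)
      (Int.gcd (Module.finrank K U) (d - Module.finrank K U - Module.finrank K W)) := by
  have hUW : U ⊓ W = W := inf_eq_right.mpr hWU
  have hrank : Module.finrank K (W.comap U.subtype) = Module.finrank K W := by
    rw [finrank_comap_subtype, hUW]
  rw [isFrobenius_stab_inf_skewStab_iff_of_le hWU, h (hQ.restrict U)
    (nondegOn_comap_subtype (hUW.symm ▸ hW)) (hrank ▸ hr) U.subtype_injective hd, hrank]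

variable [NeZero (2 : K)]

theorem isFrobenius_stab_inf_skewStab_iff_of_codisjoint_of_lt {d b : ℕ} (hQ : Q.IsSymm)
    (hW : NondegOn Q W) (hUW : Codisjoint U W) (hM : NondegOn Q (U ⊓ W))
    (hd : Module.finrank K V = d) (hb : Module.finrank K U + b = d)
    (hbr : b < Module.finrank K W) :
    IsFrobenius K ↥(stab U ⊓ skewStab W Q) ↔
      IsFrobeniusPair (Module.finrank K W) (Int.gcd d (b - Module.finrank K W)) := by
  have hdim := Submodule.finrank_sup_add_finrank_inf_eq U W
  rw [hUW.eq_top, finrank_top] at hdim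
  have hinf : Module.finrank K ↥(U ⊓ W) = Module.finrank K W - b := by omega
  have hU : Module.finrank K U = d - b := by omega
  have hle : Module.finrank K V ≤ Module.finrank K U + 1 ↔ b ≤ 1 := by omega
  rw [isFrobenius_stab_inf_skewStab_iff_of_codisjoint hQ hUW hW hM, isFrobenius_skewStab_iff
    (hQ.restrict U) (nondegOn_comap_subtype hM) (by rw [finrank_comap_subtype]; omega),
    isFrobeniusPair_gcd_sub_iff_of_lt hbr (by omega), finrank_comap_subtype, hle, hinf, hU]

theorem quotCriterion_of_subCriterion {n : ℕ} (hquot : ∀ m < n, QuotCriterion.{u} K m)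
    (hsub : ∀ d ≤ n, SubCriterion.{u} K d) : QuotCriterion.{u} K n := by
  intro Z V _ _ _ _ _ _ W Q π hQ hW hr hπ hn
  have hZW := W.finrank_quotient_add_finrank
  by_cases h0 : Module.finrank K (Z ⧸ W) = 0
  · have : Subsingleton (Z ⧸ W) := Module.finrank_zero_iff.mp h0
    have hsub0 : (Module.finrank K Z - Module.finrank K W : ℤ) = 0 := by omega
    have hker := finrank_add_finrank_ker_of_surjective hπ
    rw [isFrobenius_quotExt_iff_of_subsingleton, isFrobenius_skewStab_iff hQ hW hr, hsub0,
      Int.gcd_zero_right, Int.natAbs_natCast, IsFrobeniusPair, Nat.odd_iff]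
    omega
  rw [isFrobenius_quotExt_iff_of_surjective quotRep_surjective hπ]
  rcases le_or_gt (Module.finrank K (Z ⧸ W)) (Module.finrank K (LinearMap.ker π)) with hle | hlt
  · refine exists_and_iff_of_forall (fun ξ hξ => ?_) fun _ => ?_
    · have hsurj : Function.Surjective ξ := hξ.elim (fun h =>
        (LinearMap.injective_iff_surjective_of_finrank_eq_finrank
          ((LinearMap.finrank_le_finrank_of_injective h).antisymm hle)).mp h) id
      have hker := finrank_add_finrank_ker_of_surjective hsurj
      have hadd : (n : ℤ) = (Module.finrank K (LinearMap.ker ξ) + Module.finrank K Z : ℕ) +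
        (Module.finrank K Z - Module.finrank K W) := by omega
      rw [hquot _ (by omega) hQ hW hr hsurj rfl, hadd, Int.gcd_add_self_left]
    · exact (exists_surjective_disjoint ⊥ (by simp) hle).imp fun ξ h => Or.inr h.1
  · refine exists_and_iff_of_forall (fun ξ hξ => ?_) fun _ =>
      (finrank_le_iff_exists_linearMap.mp hlt.le).imp fun ξ h => Or.inl h
    have hinj : Function.Injective ξ := hξ.resolve_right fun h =>
      hlt.not_ge (LinearMap.finrank_le_finrank_of_surjective h)
    have hU := finrank_comap_mkQ W (LinearMap.range ξ)
    rw [LinearMap.finrank_range_of_inj hinj] at hU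
    have hWU : W ≤ (LinearMap.range ξ).comap W.mkQ :=
      (W.ker_mkQ.symm.le).trans (LinearMap.ker_le_comap _)
    rw [isFrobenius_quotExt_quotRep_iff_of_injective hinj,
      SubCriterion.isFrobenius_stab_inf_skewStab_iff (hsub (Module.finrank K Z) (by omega)) hQ hW
        hr hWU rfl, hU]
    set k := Module.finrank K (LinearMap.ker π)
    set r := Module.finrank K W
    set z := Module.finrank K Z
    have hadd : (n : ℤ) = (k + r : ℕ) + (z - r) := by omega
    rw [hadd, Int.gcd_add_self_left, sub_right_comm, Int.gcd_sub_self_right]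

theorem subCriterion_of_quotCriterion {d : ℕ} (hquot : ∀ n < d, QuotCriterion.{u} K n)
    (hsub : ∀ e < d, SubCriterion.{u} K e) : SubCriterion.{u} K d := by
  intro X V _ _ _ _ _ _ W Q i hQ hW hr hi hd
  have hcodim := (LinearMap.range i).finrank_quotient_add_finrank
  rw [LinearMap.finrank_range_of_inj hi, hd] at hcodim
  have hWX := W.finrank_le
  have hb : (d - Module.finrank K X : ℤ) = Module.finrank K (V ⧸ LinearMap.range i) := by omega
  rw [isFrobenius_subExt_skewStab_iff hQ hW hi, hb]
  rcases le_or_gt (Module.finrank K X) (Module.finrank K (V ⧸ LinearMap.range i)) with hle | hlt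
  · refine exists_and_iff_of_forall (fun ξ hξ => ?_) fun _ =>
      (finrank_le_iff_exists_linearMap.mp hle).imp fun ξ hξ => Or.inl hξ
    have hinj : Function.Injective ξ :=
      hξ.elim id fun h => injective_of_surjective_of_finrank_le h.1 hle
    rw [hsub _ (by omega) hQ hW hr hinj rfl, sub_right_comm, Int.gcd_sub_self_right]
  rcases le_or_gt (Module.finrank K W) (Module.finrank K (V ⧸ LinearMap.range i)) with hrb | hbr
  · refine exists_and_iff_of_forall (fun ξ hξ => ?_) fun _ =>
      (exists_surjective_disjoint W hrb hlt.le).imp fun ξ h => Or.inr ⟨h.1, Or.inl h.2⟩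
    obtain ⟨hsurj, hker⟩ := hξ.resolve_left fun h =>
      hlt.not_ge (LinearMap.finrank_le_finrank_of_injective h)
    have hdim := finrank_add_finrank_ker_of_surjective hsurj
    have hdisj : Disjoint (LinearMap.ker ξ) W :=
      hker.elim id fun h => disjoint_of_codisjoint_of_finrank_add_le h.1 (by omega)
    rw [isFrobenius_subExt_incl_iff_of_surjective _ hsurj,
      QuotCriterion.isFrobenius_stab_inf_skewStab_iff (hquot (Module.finrank K X) (by omega)) hQ hW
        hr hdisj rfl ((add_comm _ _).trans hdim)]
  · refine exists_and_iff_of_forall (fun ξ hξ => ?_) fun h => ?_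
    · obtain ⟨hsurj, hker⟩ := hξ.resolve_left fun h =>
        hlt.not_ge (LinearMap.finrank_le_finrank_of_injective h)
      have hdim := finrank_add_finrank_ker_of_surjective hsurj
      obtain ⟨hcodisj, hnondeg⟩ := hker.resolve_left fun h => by
        have := Submodule.finrank_add_finrank_le_of_disjoint h
        omega
      rw [isFrobenius_subExt_incl_iff_of_surjective _ hsurj,
        isFrobenius_stab_inf_skewStab_iff_of_codisjoint_of_lt hQ hW hcodisj hnondeg rfl
          (by omega) hbr]
    · have hb1 := ((isFrobeniusPair_gcd_sub_iff_of_lt hbr hlt.le).mp h).2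
      exact (exists_surjective_codisjoint_nondegOn hQ hW
        (Submodule.one_le_finrank_iff.mp hr) hb1).imp fun ξ h => Or.inr ⟨h.1, Or.inr h.2⟩

theorem quotCriterion_and_subCriterion (m : ℕ) :
    QuotCriterion.{u} K m ∧ SubCriterion.{u} K m := by
  induction m using Nat.strong_induction_on with
  | _ m ih =>
    have hsub : SubCriterion.{u} K m :=
      subCriterion_of_quotCriterion (fun n hn => (ih n hn).1) fun e he => (ih e he).2
    refine ⟨quotCriterion_of_subCriterion (fun n hn => (ih n hn).1) fun d hd => ?_, hsub⟩
    exact hd.eq_or_lt.elim (fun h => h ▸ hsub) fun h => (ih d h).2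

end Criterion

section SymmetricTensors

open Matrix

variable {K : Type*} [Field K] {m : Type*} [Fintype m] {U W : Submodule K (m → K)}

/-- The symmetric square of a subspace `W` of `Kᵐ`: the symmetric matrices with range in `W`. -/
def symTensor (W : Submodule K (m → K)) : Submodule K (Matrix m m K) where
  carrier := {B | B.IsSymm ∧ ∀ v, B *ᵥ v ∈ W}
  add_mem' hB hC := ⟨hB.1.add hC.1, fun v => by
    rw [add_mulVec]; exact W.add_mem (hB.2 v) (hC.2 v)⟩
  zero_mem' := ⟨isSymm_zero, fun v => by rw [zero_mulVec]; exact W.zero_mem⟩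
  smul_mem' t B hB := ⟨hB.1.smul t, fun v => by rw [smul_mulVec]; exact W.smul_mem t (hB.2 v)⟩

theorem vecMulVec_self_mem_symTensor {w : m → K} (hw : w ∈ W) : vecMulVec w w ∈ symTensor W := by
  refine ⟨transpose_vecMulVec w w, fun v => ?_⟩
  rw [vecMulVec_mulVec, op_smul_eq_smul]
  exact W.smul_mem _ hw

theorem vecMulVec_add_vecMulVec_mem_symTensor {w w' : m → K} (hw : w ∈ W) (hw' : w' ∈ W) :
    vecMulVec w w' + vecMulVec w' w ∈ symTensor W := by
  refine ⟨?_, fun v => ?_⟩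
  · rw [← transpose_vecMulVec w w']
    exact isSymm_add_transpose_self _
  · rw [add_mulVec, vecMulVec_mulVec, vecMulVec_mulVec, op_smul_eq_smul, op_smul_eq_smul]
    exact W.add_mem (W.smul_mem _ hw) (W.smul_mem _ hw')

theorem trace_mul_transpose_of_isSymm {B : Matrix m m K} (hB : B.IsSymm) (N : Matrix m m K) :
    (B * Nᵀ).trace = (B * N).trace := by
  rw [← trace_transpose, transpose_mul, transpose_transpose, hB.eq, trace_mul_comm]

theorem exists_trace_mul_eq (f : Module.Dual K (Matrix m m K)) :
    ∃ N : Matrix m m K, ∀ B, (B * N).trace = f B := by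
  classical
  refine ⟨of fun i j => f (single j i 1), fun B => ?_⟩
  conv_rhs => rw [matrix_eq_sum_single B]
  simp only [map_sum, trace, diag_apply, mul_apply, of_apply]
  refine Finset.sum_congr rfl fun i _ => Finset.sum_congr rfl fun j _ => ?_
  rw [← smul_eq_mul, ← map_smul, smul_single, smul_eq_mul, mul_one]

theorem exists_dotProduct_ne_zero_of_notMem {v : m → K} (hv : v ∉ U) :
    ∃ φ, φ ⬝ᵥ v ≠ 0 ∧ ∀ u ∈ U, φ ⬝ᵥ u = 0 := by
  classical
  obtain ⟨f, hfv, hfU⟩ := Submodule.exists_le_ker_of_notMem hv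
  obtain ⟨φ, rfl⟩ := (dotProductEquiv K m).surjective f
  exact ⟨φ, hfv, hfU⟩

variable [DecidableEq m]

theorem mul_add_mul_transpose_mem_symTensor {A : Module.End K (m → K)} (hA : A ∈ stab W)
    {B : Matrix m m K} (hB : B ∈ symTensor W) :
    LinearMap.toMatrix' A * B + B * (LinearMap.toMatrix' A)ᵀ ∈ symTensor W := by
  refine ⟨?_, fun v => ?_⟩
  · rw [← hB.1.eq, ← transpose_mul, hB.1.eq]
    exact isSymm_add_transpose_self _
  · rw [add_mulVec, ← mulVec_mulVec, ← mulVec_mulVec, LinearMap.toMatrix'_mulVec]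
    exact W.add_mem (hA _ (hB.2 v)) (hB.2 _)

/-- The action `A • B = AB + BAᵀ` of endomorphisms preserving `W` on the symmetric square
of `W`. -/
def symAct {s : LieSubalgebra K (Module.End K (m → K))} (hs : s ≤ stab W) :
    s →ₗ⁅K⁆ Module.End K (symTensor W) where
  toFun A :=
    { toFun B := ⟨_, mul_add_mul_transpose_mem_symTensor (hs A.2) B.2⟩
      map_add' B C := Subtype.ext (by
        simp only [Submodule.coe_add, mul_add, add_mul, add_add_add_comm])
      map_smul' t B := Subtype.ext (by
        simp only [Submodule.coe_smul, mul_smul_comm, smul_mul_assoc, ← smul_add,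
          RingHom.id_apply]) }
  map_add' A A' := LinearMap.ext fun B => Subtype.ext (by
    simp [add_mul, mul_add, add_add_add_comm])
  map_smul' t A := LinearMap.ext fun B => Subtype.ext (by simp [smul_add])
  map_lie' {A A'} := LinearMap.ext fun B => Subtype.ext (by
    simp only [LieSubalgebra.coe_bracket, LieRing.of_associative_ring_bracket, map_sub,
      LinearMap.toMatrix'_mul, LinearMap.sub_apply, Module.End.mul_apply, Submodule.coe_sub,
      LinearMap.coe_mk, AddHom.coe_mk, transpose_sub, transpose_mul]
    noncomm_ring)

theorem coe_symAct_apply {s : LieSubalgebra K (Module.End K (m → K))} (hs : s ≤ stab W) (A : s)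
    (B : symTensor W) : (symAct hs A B : Matrix m m K) =
      LinearMap.toMatrix' A.1 * B + B * (LinearMap.toMatrix' A.1)ᵀ := rfl

/-- The functional `B ↦ tr (BN)` on the symmetric square of `W`. -/
def traceFunctional (W : Submodule K (m → K)) (N : Matrix m m K) : Module.Dual K (symTensor W) :=
  traceLinearMap m K K ∘ₗ LinearMap.mulRight K N ∘ₗ (symTensor W).subtype

theorem traceFunctional_apply (N : Matrix m m K) (B : symTensor W) :
    traceFunctional W N B = (B.1 * N).trace := rfl

theorem trace_mul_vecMulVec_mul (M N : Matrix m m K) (v w : m → K) :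
    (M * vecMulVec v w * N).trace = toBilin' N w (M *ᵥ v) := by
  rw [mul_vecMulVec, vecMulVec_mul, trace_vecMulVec, dotProduct_comm, ← dotProduct_mulVec,
    toBilin'_apply']

theorem traceFunctional_symAct {s : LieSubalgebra K (Module.End K (m → K))} (hs : s ≤ stab W)
    {N : Matrix m m K} (hN : N.IsSymm) (A : s) (B : symTensor W) :
    traceFunctional W N (symAct hs A B) = 2 * (LinearMap.toMatrix' A.1 * B.1 * N).trace := by
  have htr : (B.1 * (LinearMap.toMatrix' A.1)ᵀ * N).trace =
      (LinearMap.toMatrix' A.1 * B.1 * N).trace := by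
    rw [← trace_transpose, transpose_mul, transpose_mul, transpose_transpose, B.2.1.eq, hN.eq,
      trace_mul_comm]
  rw [traceFunctional_apply, coe_symAct_apply, add_mul, trace_add, htr, two_mul]

theorem trace_mul_eq_zero_of_mem_symTensor {B S : Matrix m m K} (hB : B ∈ symTensor W)
    (hS : ∀ w ∈ W, ∀ w' ∈ W, toBilin' S w w' = 0) : (B * S).trace = 0 := by
  obtain ⟨p, hp⟩ := W.subtype.exists_leftInverse_of_injective W.ker_subtype
  set P : Matrix m m K := LinearMap.toMatrix' (W.subtype ∘ₗ p)
  have hP : ∀ v, P *ᵥ v = p v := LinearMap.toMatrix'_mulVec _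
  have hPB : P * B = B := toLin'.injective (LinearMap.ext fun v => by
    rw [toLin'_apply, toLin'_apply, ← mulVec_mulVec, hP]
    exact congrArg Subtype.val (LinearMap.congr_fun hp ⟨_, hB.2 v⟩))
  have hBP : B * Pᵀ = B := by rw [← hB.1.eq, ← transpose_mul, hPB]
  have hPSP : Pᵀ * S * P = 0 := toBilin'.injective (LinearMap.ext₂ fun v w => by
    rw [← toBilin'_comp, LinearMap.BilinForm.comp_apply, toLin'_apply, toLin'_apply, hP, hP,
      hS _ (p v).2 _ (p w).2, map_zero, LinearMap.zero_apply, LinearMap.zero_apply])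
  calc (B * S).trace = (P * (B * Pᵀ) * S).trace := by rw [hBP, hPB]
    _ = (B * (Pᵀ * S * P)).trace := by
      rw [Matrix.mul_assoc, trace_mul_comm]
      simp only [Matrix.mul_assoc]
    _ = 0 := by rw [hPSP, mul_zero, trace_zero]

theorem nondegOn_of_hasOpenOrbit {s : LieSubalgebra K (Module.End K (m → K))}
    (hs : s ≤ stab W) {N : Matrix m m K} (hN : N.IsSymm)
    (h : HasOpenOrbit (symAct hs) (traceFunctional W N)) (hUW : U ≤ W) (hsU : s ≤ stab U) :
    NondegOn (toBilin' N) U := fun w hw hww => by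
  have hzero := h ⟨_, vecMulVec_self_mem_symTensor (hUW hw)⟩ fun A => by
    rw [traceFunctional_symAct hs hN, trace_mul_vecMulVec_mul, LinearMap.toMatrix'_mulVec,
      hww _ (hsU A.2 w hw), mul_zero]
  exact or_self_iff.mp (vecMulVec_eq_zero.mp (congrArg Subtype.val hzero))

theorem toLin'_vecMulVec_mem_stab {u φ : m → K} (h : u ∈ U ∨ ∀ v ∈ U, φ ⬝ᵥ v = 0) :
    toLin' (vecMulVec u φ) ∈ stab U := fun v hv => by
  rw [toLin'_apply, vecMulVec_mulVec, op_smul_eq_smul]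
  rcases h with hu | hφ
  · exact U.smul_mem _ hu
  · rw [hφ v hv, zero_smul]
    exact U.zero_mem

variable [NeZero (2 : K)]

theorem exists_isSymm_traceFunctional_eq (ξ : Module.Dual K (symTensor W)) :
    ∃ N, N.IsSymm ∧ traceFunctional W N = ξ := by
  obtain ⟨f, rfl⟩ := ξ.exists_extend
  obtain ⟨N, hN⟩ := exists_trace_mul_eq f
  refine ⟨(2⁻¹ : K) • (N + Nᵀ), (isSymm_add_transpose_self N).smul _, LinearMap.ext fun B => ?_⟩
  rw [traceFunctional_apply, mul_smul_comm, mul_add, trace_smul, trace_add,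
    trace_mul_transpose_of_isSymm B.2.1, hN, ← two_mul, smul_eq_mul,
    inv_mul_cancel_left₀ two_ne_zero]
  rfl

theorem mem_dualStabilizer_symAct_iff {s : LieSubalgebra K (Module.End K (m → K))}
    (hs : s ≤ stab W) {N : Matrix m m K} (hN : N.IsSymm) {A : s} :
    A ∈ dualStabilizer (symAct hs) (traceFunctional W N) ↔ A.1 ∈ skewStab W (toBilin' N) := by
  have hmem : A ∈ dualStabilizer (symAct hs) (traceFunctional W N) ↔
      ∀ B : symTensor W, (LinearMap.toMatrix' A.1 * B.1 * N).trace = 0 :=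
    forall_congr' fun B => by
      rw [traceFunctional_symAct hs hN, mul_eq_zero_iff_left two_ne_zero]
  have hsymm := (isSymm_toBilin'_iff_isSymm.mpr hN).eq
  rw [hmem]
  refine ⟨fun h => ⟨hs A.2, fun w hw w' hw' => ?_⟩, fun h B => ?_⟩
  · have hB := h ⟨_, vecMulVec_add_vecMulVec_mem_symTensor hw hw'⟩
    rw [mul_add, add_mul, trace_add, trace_mul_vecMulVec_mul, trace_mul_vecMulVec_mul,
      LinearMap.toMatrix'_mulVec, LinearMap.toMatrix'_mulVec] at hB
    rw [← hB, hsymm]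
  · set M := LinearMap.toMatrix' A.1
    have hS : (B.1 * (N * M + Mᵀ * N)).trace = 0 :=
      trace_mul_eq_zero_of_mem_symTensor B.2 fun w hw w' hw' => by
        rw [map_add, LinearMap.add_apply, LinearMap.add_apply, ← h.2 w hw w' hw', add_comm]
        congr 1
        · rw [toBilin'_apply', toBilin'_apply', ← mulVec_mulVec, dotProduct_mulVec,
            vecMul_transpose, LinearMap.toMatrix'_mulVec]
        · rw [toBilin'_apply', toBilin'_apply', ← mulVec_mulVec, LinearMap.toMatrix'_mulVec]
    have hMt : (B.1 * (Mᵀ * N)).trace = (B.1 * (N * M)).trace := by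
      rw [← trace_mul_transpose_of_isSymm B.2.1, transpose_mul, transpose_transpose, hN.eq]
    rw [mul_add, trace_add, hMt, ← two_mul, mul_eq_zero_iff_left two_ne_zero] at hS
    rw [Matrix.mul_assoc, trace_mul_comm, Matrix.mul_assoc, hS]

theorem isFrobenius_dualStabilizer_symAct_iff {s : LieSubalgebra K (Module.End K (m → K))}
    (hs : s ≤ stab W) {N : Matrix m m K} (hN : N.IsSymm) :
    IsFrobenius K (dualStabilizer (symAct hs) (traceFunctional W N)) ↔
      IsFrobenius K ↥(s ⊓ skewStab W (toBilin' N)) := by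
  set φ := s.incl.comp (dualStabilizer (symAct hs) (traceFunctional W N)).incl
  have hφ : Function.Injective φ := Subtype.val_injective.comp Subtype.val_injective
  have hrange : φ.range = s ⊓ skewStab W (toBilin' N) := by
    ext A
    refine ⟨?_, fun hA => ⟨⟨⟨A, hA.1⟩, (mem_dualStabilizer_symAct_iff hs hN).mpr hA.2⟩, rfl⟩⟩
    rintro ⟨A, rfl⟩
    exact ⟨A.1.2, (mem_dualStabilizer_symAct_iff hs hN).mp A.2⟩
  rw [← hrange, isFrobenius_range_iff hφ]

theorem hasOpenOrbit_symAct_of_nondegOn {N : Matrix m m K} (hN : N.IsSymm)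
    (hW : NondegOn (toBilin' N) W) (hUW : NondegOn (toBilin' N) (U ⊓ W)) :
    HasOpenOrbit (symAct (inf_le_right : stab U ⊓ stab W ≤ stab W)) (traceFunctional W N) := by
  intro B hB
  have hker : ∀ φ, ∀ u ∈ W, toLin' (vecMulVec u φ) ∈ stab U → toBilin' N (B.1 *ᵥ φ) u = 0 := by
    intro φ u hu hmem
    have h := hB ⟨_, hmem, toLin'_vecMulVec_mem_stab (Or.inl hu)⟩
    rw [traceFunctional_symAct _ hN, mul_eq_zero_iff_left two_ne_zero, LinearMap.toMatrix'_toLin',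
      vecMulVec_mul, vecMulVec_mul, trace_vecMulVec, ← mulVec_transpose B.1, B.2.1.eq,
      dotProduct_comm, ← dotProduct_mulVec, ← toBilin'_apply'] at h
    exact h
  have hannih : ∀ φ, (∀ v ∈ U, φ ⬝ᵥ v = 0) → B.1 *ᵥ φ = 0 := fun φ hφ =>
    hW _ (B.2.2 φ) fun u hu => hker φ u hu (toLin'_vecMulVec_mem_stab (Or.inr hφ))
  have hrange : ∀ φ, B.1 *ᵥ φ ∈ U := by
    refine fun φ => by_contra fun hφ => ?_
    obtain ⟨ψ, hψ, hψU⟩ := exists_dotProduct_ne_zero_of_notMem hφ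
    rw [dotProduct_mulVec, ← mulVec_transpose, B.2.1.eq, hannih ψ hψU, zero_dotProduct] at hψ
    exact hψ rfl
  refine Subtype.ext (toLin'.injective (LinearMap.ext fun φ => ?_))
  rw [toLin'_apply, Submodule.coe_zero, map_zero, LinearMap.zero_apply]
  exact hUW _ ⟨hrange φ, B.2.2 φ⟩ fun u hu =>
    hker φ u hu.2 (toLin'_vecMulVec_mem_stab (Or.inl hu.1))

theorem hasOpenOrbit_symAct_iff {N : Matrix m m K} (hN : N.IsSymm) :
    HasOpenOrbit (symAct (inf_le_right : stab U ⊓ stab W ≤ stab W)) (traceFunctional W N) ↔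
      NondegOn (toBilin' N) W ∧ NondegOn (toBilin' N) (U ⊓ W) := by
  refine ⟨fun h => ⟨?_, ?_⟩, fun h => hasOpenOrbit_symAct_of_nondegOn hN h.1 h.2⟩
  · exact nondegOn_of_hasOpenOrbit _ hN h le_rfl inf_le_right
  · exact nondegOn_of_hasOpenOrbit _ hN h inf_le_right fun A hA v hv =>
      ⟨hA.1 v hv.1, hA.2 v hv.2⟩

end SymmetricTensors

section Seaweed

open Matrix

variable {K : Type*} [Field K] {m : Type*}

theorem spanSubset_inf_spanSubset [Finite m] {s t : Set m} :
    Pi.spanSubset K s ⊓ Pi.spanSubset K t = Pi.spanSubset K (s ∩ t) := by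
  ext v
  simp only [Submodule.mem_inf, Pi.mem_spanSubset_iff, Set.mem_inter_iff, not_and_or, or_imp,
    forall_and]

theorem disjoint_spanSubset [Finite m] {s t : Set m} (h : Disjoint s t) :
    Disjoint (Pi.spanSubset K s) (Pi.spanSubset K t) := by
  rw [disjoint_iff, spanSubset_inf_spanSubset, h.inter_eq, Pi.spanSubset, Set.image_empty,
    Submodule.span_empty]

theorem codisjoint_spanSubset [Finite m] {s t : Set m} (h : s ∪ t = Set.univ) :
    Codisjoint (Pi.spanSubset K s) (Pi.spanSubset K t) := by
  rw [codisjoint_iff, Pi.spanSubset, Pi.spanSubset, ← Submodule.span_union, ← Set.image_union, h,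
    Set.image_univ, Module.Basis.span_eq]

theorem mem_symTensor_spanSubset_iff [Fintype m] {s : Set m} {B : Matrix m m K} :
    B ∈ symTensor (Pi.spanSubset K s) ↔ B.IsSymm ∧ ∀ i ∉ s, ∀ j, B i j = 0 := by
  classical
  refine and_congr_right fun _ => ⟨fun h i hi j => ?_, fun h v => ?_⟩
  · have hcol := Pi.mem_spanSubset_iff.mp (h (Pi.single j 1)) i hi
    rwa [mulVec_single_one] at hcol
  · exact Pi.mem_spanSubset_iff.mpr fun i hi =>
      Finset.sum_eq_zero fun j _ => mul_eq_zero_of_left (h i hi j) _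

variable [Fintype m] [DecidableEq m]

theorem isFrobenius_iff_exists_nondegOn [NeZero (2 : K)] {R : Type*} [LieRing R] [LieAlgebra K R]
    {P : LieSubalgebra K R} {U W : Submodule K (m → K)}
    {ι : ↥(stab U ⊓ stab W) →ₗ⁅K⁆ R} {κ : symTensor W →ₗ[K] R}
    (h : IsSemidirect P (symAct inf_le_right) ι κ) :
    IsFrobenius K P ↔ ∃ Q : LinearMap.BilinForm K (m → K), Q.IsSymm ∧
      (NondegOn Q W ∧ NondegOn Q (U ⊓ W)) ∧ IsFrobenius K ↥(stab U ⊓ skewStab W Q) := by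
  have hle : ∀ Q, stab U ⊓ stab W ⊓ skewStab W Q = stab U ⊓ skewStab W Q := fun Q => by
    rw [inf_assoc, inf_eq_right.mpr (show skewStab W Q ≤ stab W from fun _ hA => hA.1)]
  rw [h.isFrobenius_iff_exists_hasOpenOrbit]
  constructor
  · rintro ⟨ξ, hξ, hfrob⟩
    obtain ⟨N, hN, rfl⟩ := exists_isSymm_traceFunctional_eq ξ
    rw [isFrobenius_dualStabilizer_symAct_iff _ hN, hle] at hfrob
    exact ⟨_, isSymm_toBilin'_iff_isSymm.mpr hN, (hasOpenOrbit_symAct_iff hN).mp hξ, hfrob⟩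
  · rintro ⟨Q, hQ, hnondeg, hfrob⟩
    obtain ⟨N, rfl⟩ := toBilin'.surjective Q
    have hN := isSymm_toBilin'_iff_isSymm.mp hQ
    refine ⟨_, (hasOpenOrbit_symAct_iff hN).mpr hnondeg, ?_⟩
    rwa [isFrobenius_dualStabilizer_symAct_iff _ hN, hle]

theorem not_isFrobenius_stab_inf_skewStab_bot {V : Type*} [AddCommGroup V] [Module K V]
    [Nontrivial V] (U : Submodule K V) (Q : LinearMap.BilinForm K V) :
    ¬ IsFrobenius K ↥(stab U ⊓ skewStab ⊥ Q) := fun h => by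
  have hmem : (1 : Module.End K V) ∈ stab U ⊓ skewStab ⊥ Q :=
    ⟨fun u hu => hu, fun w hw => hw, fun w hw w' _ => by
      rw [(Submodule.mem_bot K).mp hw, map_zero, map_zero, LinearMap.zero_apply,
        LinearMap.zero_apply, add_zero]⟩
  have hcenter : (⟨1, hmem⟩ : ↥(stab U ⊓ skewStab ⊥ Q)) ∈ LieAlgebra.center K _ := fun A =>
    Subtype.ext ((Commute.one_right A.1).lie_eq)
  rw [h.center_eq_bot, LieSubmodule.mem_bot] at hcenter
  exact one_ne_zero (congrArg Subtype.val hcenter)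

section CoordinateSubspaces

variable {s : Set m}

theorem toLin'_mem_stab_spanSubset_iff {M : Matrix m m K} :
    toLin' M ∈ stab (Pi.spanSubset K s) ↔ ∀ i ∉ s, ∀ j ∈ s, M i j = 0 := by
  refine ⟨fun h i hi j hj => ?_, fun h v hv => Pi.mem_spanSubset_iff.mpr fun i hi => ?_⟩
  · have hsingle : Pi.single j 1 ∈ Pi.spanSubset K s := Pi.mem_spanSubset_iff.mpr fun k hk =>
      Pi.single_eq_of_ne (ne_of_mem_of_not_mem hj hk).symm 1
    have hcol := Pi.mem_spanSubset_iff.mp (h _ hsingle) i hi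
    rwa [toLin'_apply, mulVec_single_one] at hcol
  · refine Finset.sum_eq_zero fun j _ => ?_
    by_cases hj : j ∈ s
    · exact mul_eq_zero_of_left (h i hi j hj) _
    · exact mul_eq_zero_of_right _ (Pi.mem_spanSubset_iff.mp hv j hj)

theorem nondegOn_spanSubset : NondegOn (toBilin' (1 : Matrix m m K)) (Pi.spanSubset K s) := by
  intro v hv h
  ext i
  by_cases hi : i ∈ s
  · have hsingle : Pi.single i 1 ∈ Pi.spanSubset K s := Pi.mem_spanSubset_iff.mpr fun k hk =>
      Pi.single_eq_of_ne (ne_of_mem_of_not_mem hi hk).symm 1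
    have hvi := h _ hsingle
    rwa [toBilin'_apply', one_mulVec, dotProduct_single_one] at hvi
  · exact Pi.mem_spanSubset_iff.mp hv i hi

variable (K) in
/-- The span `F_a` of the first `a` standard basis vectors of `Kⁿ`. -/
noncomputable def firstCoords (n a : ℕ) : Submodule K (Fin n → K) :=
  Pi.spanSubset K {i | (i : ℕ) < a}

variable (K) in
/-- The span of all but the first `c` standard basis vectors of `Kⁿ`. -/
noncomputable def lastCoords (n c : ℕ) : Submodule K (Fin n → K) :=
  Pi.spanSubset K {i | c ≤ (i : ℕ)}

variable {n a c : ℕ}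

theorem disjoint_firstCoords_lastCoords (h : a ≤ c) :
    Disjoint (firstCoords K n a) (lastCoords K n c) :=
  disjoint_spanSubset (Set.disjoint_left.mpr fun _ hi hi' => (hi.trans_le h).not_ge hi')

theorem codisjoint_firstCoords_lastCoords (h : c ≤ a) :
    Codisjoint (firstCoords K n a) (lastCoords K n c) :=
  codisjoint_spanSubset (Set.eq_univ_of_forall fun i => (lt_or_ge (i : ℕ) a).imp id h.trans)

theorem finrank_firstCoords (h : a ≤ n) : Module.finrank K (firstCoords K n a) = a := by
  rw [firstCoords, Pi.dim_spanSubset, Set.ncard_eq_toFinset_card', Set.toFinset_ofPred,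
    Fin.card_filter_val_lt, min_eq_right h]

theorem finrank_lastCoords (h : c ≤ n) : Module.finrank K (lastCoords K n c) = n - c := by
  have hcompl : {i : Fin n | c ≤ (i : ℕ)} = {i : Fin n | (i : ℕ) < c}ᶜ :=
    by simp only [Set.compl_ofPred, not_lt]
  rw [lastCoords, Pi.dim_spanSubset, hcompl, Set.ncard_compl, Nat.card_fin,
    Set.ncard_eq_toFinset_card', Set.toFinset_ofPred, Fin.card_filter_val_lt, min_eq_right h]

end CoordinateSubspaces

section SemidirectProduct

theorem lie_fromBlocks_zero (A B D A' B' D' : Matrix m m K) :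
    ⁅fromBlocks A B 0 D, fromBlocks A' B' 0 D'⁆ =
      fromBlocks ⁅A, A'⁆ (A * B' + B * D' - (A' * B + B' * D)) 0 ⁅D, D'⁆ := by
  simp only [LieRing.of_associative_ring_bracket, fromBlocks_multiply, mul_zero, zero_mul,
    add_zero, zero_add, sub_eq_add_neg, fromBlocks_neg, fromBlocks_add, neg_zero]

variable (K m) in
/-- The embedding of `𝔤𝔩(m)` as the Levi subalgebra of block diagonal matrices `[A, 0; 0, -Aᵀ]`
of `𝔰𝔭(2m)`. -/
def leviEmbedding : Module.End K (m → K) →ₗ⁅K⁆ Matrix (m ⊕ m) (m ⊕ m) K where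
  toFun A := fromBlocks (LinearMap.toMatrix' A) 0 0 (-(LinearMap.toMatrix' A)ᵀ)
  map_add' A A' := by
    rw [fromBlocks_add, map_add, transpose_add, neg_add, add_zero]
  map_smul' t A := by
    rw [RingHom.id_apply, fromBlocks_smul, map_smul, transpose_smul, smul_neg, smul_zero]
  map_lie' {A A'} := by
    rw [lie_fromBlocks_zero]
    simp only [LieRing.of_associative_ring_bracket, map_sub, LinearMap.toMatrix'_mul,
      transpose_sub, transpose_mul, mul_zero, zero_mul, add_zero, neg_mul_neg, sub_zero, neg_sub]

/-- The embedding of the symmetric square of `W` into the abelian subalgebra of block matrices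
`[0, B; 0, 0]` of `𝔰𝔭(2m)`. -/
def radicalEmbedding (W : Submodule K (m → K)) : symTensor W →ₗ[K] Matrix (m ⊕ m) (m ⊕ m) K where
  toFun B := fromBlocks 0 B.1 0 0
  map_add' B B' := by rw [fromBlocks_add, Submodule.coe_add, add_zero]
  map_smul' t B := by rw [RingHom.id_apply, fromBlocks_smul, Submodule.coe_smul, smul_zero]

theorem leviEmbedding_add_radicalEmbedding {W : Submodule K (m → K)}
    (A : Module.End K (m → K)) (B : symTensor W) :
    leviEmbedding K m A + radicalEmbedding W B =
      fromBlocks (LinearMap.toMatrix' A) B 0 (-(LinearMap.toMatrix' A)ᵀ) := by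
  change fromBlocks _ _ _ _ + fromBlocks _ _ _ _ = _
  rw [fromBlocks_add, add_zero, zero_add, zero_add, add_zero]

theorem isSemidirect_symAct {s : LieSubalgebra K (Module.End K (m → K))}
    {W : Submodule K (m → K)} (hs : s ≤ stab W) {P : LieSubalgebra K (Matrix (m ⊕ m) (m ⊕ m) K)}
    (hP : ∀ X, X ∈ P ↔ toLin' X.toBlocks₁₁ ∈ s ∧ X.toBlocks₁₂ ∈ symTensor W ∧
      X.toBlocks₂₁ = 0 ∧ X.toBlocks₂₂ = -X.toBlocks₁₁ᵀ) :
    IsSemidirect P (symAct hs) ((leviEmbedding K m).comp s.incl) (radicalEmbedding W) where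
  mem_iff X := by
    constructor
    · intro hX
      obtain ⟨h₁₁, h₁₂, h₂₁, h₂₂⟩ := (hP X).mp hX
      refine ⟨⟨_, h₁₁⟩, ⟨_, h₁₂⟩, (leviEmbedding_add_radicalEmbedding _ _).trans ?_⟩
      conv_rhs => rw [← fromBlocks_toBlocks X, h₂₁, h₂₂]
      exact congrArg (fun A => fromBlocks A _ 0 (-Aᵀ)) (LinearMap.toMatrix'_toLin' _)
    · rintro ⟨A, B, rfl⟩
      refine (congrArg (· ∈ P) (leviEmbedding_add_radicalEmbedding A.1 B)).mpr ((hP _).mpr ?_)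
      rw [toBlocks_fromBlocks₁₁, toLin'_toMatrix']
      exact ⟨A.2, B.2, rfl, rfl⟩
  eq_zero A B h := by
    have hblocks := (leviEmbedding_add_radicalEmbedding A.1 B).symm.trans h
    rw [← fromBlocks_zero, fromBlocks_inj] at hblocks
    exact ⟨Subtype.ext ((LinearEquiv.map_eq_zero_iff _).mp hblocks.1), Subtype.ext hblocks.2.1⟩
  lie_act A B := by
    change ⁅fromBlocks _ _ _ _, fromBlocks _ _ _ _⁆ = fromBlocks _ (symAct hs A B).1 _ _
    rw [lie_fromBlocks_zero, coe_symAct_apply, lie_zero, lie_zero, zero_mul, add_zero, zero_add,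
      mul_neg, sub_neg_eq_add]
    rfl
  lie_abelian B B' := by
    change ⁅fromBlocks _ _ _ _, fromBlocks _ _ _ _⁆ = _
    rw [lie_fromBlocks_zero, lie_zero, zero_mul, mul_zero, zero_mul, mul_zero, add_zero, sub_self,
      fromBlocks_zero]

end SemidirectProduct

section Membership

variable {n a b c : ℕ}

theorem simpleRootsOf_pair : simpleRootsOf [a, b] = {a, a + b} := by
  ext k
  simp only [simpleRootsOf, Set.mem_ofPred_eq, Set.mem_insert_iff, Set.mem_singleton_iff]
  constructor
  · rintro ⟨i, hi, hi', rfl⟩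
    have : i = 1 ∨ i = 2 := by simp only [List.length_cons, List.length_nil] at hi'; omega
    rcases this with rfl | rfl <;> simp
  · rintro (rfl | rfl)
    · exact ⟨1, by simp⟩
    · exact ⟨2, by simp⟩

theorem simpleRootsOf_singleton : simpleRootsOf [c] = {c} := by
  ext k
  simp only [simpleRootsOf, Set.mem_ofPred_eq, Set.mem_singleton_iff]
  constructor
  · rintro ⟨i, hi, hi', rfl⟩
    obtain rfl : i = 1 := hi'.antisymm hi
    simp
  · rintro rfl
    exact ⟨1, by simp⟩

theorem le_pos_inr (i : Fin n) : n ≤ pos n (Sum.inr i) := by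
  have := i.isLt
  simp only [pos]
  omega

theorem mem_parabolic_pair_iff (ha : a ≤ n) {X : Matrix (Fin n ⊕ Fin n) (Fin n ⊕ Fin n) K} :
    X ∈ parabolic K n {a, n} ↔ X ∈ LieAlgebra.Symplectic.sp (Fin n) K ∧
      toLin' X.toBlocks₁₁ ∈ stab (firstCoords K n a) ∧ X.toBlocks₂₁ = 0 := by
  rw [mem_parabolic, firstCoords, toLin'_mem_stab_spanSubset_iff]
  simp only [Set.mem_insert_iff, Set.mem_singleton_iff, forall_eq_or_imp, forall_eq]
  refine and_congr_right fun _ => ⟨fun ⟨ha', hn⟩ => ⟨fun i hi j hj => ?_, ?_⟩,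
    fun ⟨h₁₁, h₂₁⟩ => ⟨?_, ?_⟩⟩
  · exact ha' _ _ hj (not_lt.mp hi)
  · exact Matrix.ext fun i j => hn _ _ j.isLt (le_pos_inr i)
  · rintro (i | i) (j | j) hj hi
    · exact h₁₁ i (not_lt.mpr hi) j hj
    · exact absurd hj (ha.trans (le_pos_inr j)).not_gt
    · exact congrFun₂ h₂₁ i j
    · exact absurd hj (ha.trans (le_pos_inr j)).not_gt
  · rintro (i | i) (j | j) hj hi
    · exact absurd hi i.isLt.not_ge
    · exact absurd hj (le_pos_inr j).not_gt
    · exact congrFun₂ h₂₁ i j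
    · exact absurd hj (le_pos_inr j).not_gt

theorem mem_oppParabolic_singleton_iff (hc : c ≤ n)
    {X : Matrix (Fin n ⊕ Fin n) (Fin n ⊕ Fin n) K} :
    X ∈ oppParabolic K n {c} ↔ X ∈ LieAlgebra.Symplectic.sp (Fin n) K ∧
      toLin' X.toBlocks₁₁ ∈ stab (lastCoords K n c) ∧
      X.toBlocks₁₂ ∈ symTensor (lastCoords K n c) := by
  rw [mem_oppParabolic, lastCoords, toLin'_mem_stab_spanSubset_iff, mem_symTensor_spanSubset_iff]
  simp only [Set.mem_singleton_iff, forall_eq]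
  refine and_congr_right fun hX => ⟨fun h => ⟨fun i hi j hj => ?_,
    ((mem_sp_iff X).mp hX).2.1, fun i hi j => ?_⟩, fun ⟨h₁₁, _, h₁₂⟩ => ?_⟩
  · exact h _ _ (not_le.mp hi) hj
  · exact h _ _ (not_le.mp hi) (hc.trans (le_pos_inr j))
  · rintro (i | i) (j | j) hi hj
    · exact h₁₁ i (not_le.mpr hi) j hj
    · exact h₁₂ i (not_le.mpr hi) j
    · exact absurd hi (hc.trans (le_pos_inr i)).not_gt
    · exact absurd hi (hc.trans (le_pos_inr i)).not_gt

theorem mem_seaweed_iff (hab : a + b = n) (hc : c ≤ n)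
    (X : Matrix (Fin n ⊕ Fin n) (Fin n ⊕ Fin n) K) :
    X ∈ seaweed K n [a, b] [c] ↔
      toLin' X.toBlocks₁₁ ∈ stab (firstCoords K n a) ⊓ stab (lastCoords K n c) ∧
      X.toBlocks₁₂ ∈ symTensor (lastCoords K n c) ∧
      X.toBlocks₂₁ = 0 ∧ X.toBlocks₂₂ = -X.toBlocks₁₁ᵀ := by
  rw [seaweed, simpleRootsOf_pair, simpleRootsOf_singleton, hab, LieSubalgebra.mem_inf,
    mem_parabolic_pair_iff (Nat.le.intro hab), mem_oppParabolic_singleton_iff hc, mem_sp_iff,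
    LieSubalgebra.mem_inf]
  constructor
  · rintro ⟨⟨hsp, hU, h₂₁⟩, -, hW, h₁₂⟩
    exact ⟨⟨hU, hW⟩, h₁₂, h₂₁, hsp.1⟩
  · rintro ⟨⟨hU, hW⟩, h₁₂, h₂₁, h₂₂⟩
    have hsymm : X.toBlocks₂₁.IsSymm := h₂₁ ▸ isSymm_zero
    exact ⟨⟨⟨h₂₂, h₁₂.1, hsymm⟩, hU, h₂₁⟩, ⟨h₂₂, h₁₂.1, hsymm⟩, hW, h₁₂⟩

end Membership

variable [NeZero (2 : K)] {n a b c : ℕ}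

theorem isFrobenius_seaweed_iff (hab : a + b = n) (hc : c ≤ n) :
    IsFrobenius K (seaweed K n [a, b] [c]) ↔ ∃ Q : LinearMap.BilinForm K (Fin n → K), Q.IsSymm ∧
      (NondegOn Q (lastCoords K n c) ∧ NondegOn Q (firstCoords K n a ⊓ lastCoords K n c)) ∧
      IsFrobenius K ↥(stab (firstCoords K n a) ⊓ skewStab (lastCoords K n c) Q) :=
  isFrobenius_iff_exists_nondegOn (isSemidirect_symAct inf_le_right (mem_seaweed_iff hab hc))

theorem isFrobenius_stab_firstCoords_inf_skewStab_lastCoords_iff (hab : a + b = n) (hc : c < n)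
    {Q : LinearMap.BilinForm K (Fin n → K)} (hQ : Q.IsSymm) (hW : NondegOn Q (lastCoords K n c))
    (hM : NondegOn Q (firstCoords K n a ⊓ lastCoords K n c)) :
    IsFrobenius K ↥(stab (firstCoords K n a) ⊓ skewStab (lastCoords K n c) Q) ↔
      IsFrobeniusPair (n - c) (Nat.gcd (a + b) (b + c)) := by
  have hV := Module.finrank_fin_fun K (n := n)
  have hU := finrank_firstCoords (K := K) (Nat.le.intro hab)
  have hr := finrank_lastCoords (K := K) hc.le
  have hgcd : Nat.gcd (a + b) (b + c) =
      Int.gcd n (b - Module.finrank K (lastCoords K n c)) := by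
    have hadd : ((b + c : ℕ) : ℤ) = b - Module.finrank K (lastCoords K n c) + n := by omega
    rw [hab, ← Int.gcd_natCast_natCast, hadd, Int.gcd_add_self_right]
  rw [hgcd, ← hr]
  rcases le_or_gt a c with hac | hca
  · exact QuotCriterion.isFrobenius_stab_inf_skewStab_iff (quotCriterion_and_subCriterion n).1 hQ hW
      (by omega) (disjoint_firstCoords_lastCoords hac) hV (by omega)
  · exact isFrobenius_stab_inf_skewStab_iff_of_codisjoint_of_lt hQ hW
      (codisjoint_firstCoords_lastCoords hca.le) hM hV (by omega) (by omega)

theorem isFrobenius_seaweed_iff_of_lt (hab : a + b = n) (hc : c < n) :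
    IsFrobenius K (seaweed K n [a, b] [c]) ↔
      IsFrobeniusPair (n - c) (Nat.gcd (a + b) (b + c)) := by
  rw [isFrobenius_seaweed_iff hab hc.le]
  constructor
  · rintro ⟨Q, hQ, ⟨hW, hM⟩, h⟩
    exact (isFrobenius_stab_firstCoords_inf_skewStab_lastCoords_iff hab hc hQ hW hM).mp h
  · intro h
    have hQ := isSymm_toBilin'_iff_isSymm.mpr (isSymm_one (n := Fin n) (α := K))
    have hM : NondegOn (toBilin' 1) (firstCoords K n a ⊓ lastCoords K n c) := by
      rw [firstCoords, lastCoords, spanSubset_inf_spanSubset]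
      exact nondegOn_spanSubset
    exact ⟨_, hQ, ⟨nondegOn_spanSubset, hM⟩,
      (isFrobenius_stab_firstCoords_inf_skewStab_lastCoords_iff hab hc hQ nondegOn_spanSubset
        hM).mpr h⟩

theorem not_isFrobenius_seaweed_self (hn : 0 < n) (hab : a + b = n) :
    ¬ IsFrobenius K (seaweed K n [a, b] [n]) := by
  have : Nonempty (Fin n) := ⟨⟨0, hn⟩⟩
  have hbot : lastCoords K n n = ⊥ := Submodule.finrank_eq_zero.mp (by
    rw [finrank_lastCoords le_rfl, Nat.sub_self])
  rw [isFrobenius_seaweed_iff hab le_rfl, hbot]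
  rintro ⟨Q, -, -, h⟩
  exact not_isFrobenius_stab_inf_skewStab_bot _ Q h

theorem isFrobeniusPair_sub_iff (hab : a + b = n) (hc : c < n) :
    IsFrobeniusPair (n - c) (Nat.gcd (a + b) (b + c)) ↔
      (c + 1 = n ∧ Nat.gcd (a + b) (b + c) = 1) ∨
      (c + 2 = n ∧ Nat.gcd (a + b) (b + c) = 1) ∨
      (c + 3 = n ∧ Odd a ∧ Odd b ∧ Odd c ∧ Nat.gcd (a + b) (b + c) = 2) := by
  have hodd (h3 : c + 3 = n) (h : Nat.gcd (a + b) (b + c) = 2) : Odd a ∧ Odd b ∧ Odd c := by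
    have hdvd : 2 ∣ a + b := h ▸ Nat.gcd_dvd_left _ _
    have hdvd' : 2 ∣ b + c := h ▸ Nat.gcd_dvd_right _ _
    simp only [Nat.odd_iff]
    omega
  rw [IsFrobeniusPair, Nat.sub_eq_iff_eq_add' hc.le, Nat.sub_eq_iff_eq_add' hc.le,
    Nat.sub_eq_iff_eq_add' hc.le]
  grind

end Seaweed

end SymplecticSeaweed

open SymplecticSeaweed in
theorem mainTheorem2_general (K : Type*) [Field K] [NeZero (2 : K)] {n a b c : ℕ} (hn : 0 < n)
    (hab : a + b = n) (hcn : c ≤ n) :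
    index K (seaweed K n [a, b] [c]) = 0 ↔
      (c + 1 = n ∧ Nat.gcd (a + b) (b + c) = 1) ∨
      (c + 2 = n ∧ Nat.gcd (a + b) (b + c) = 1) ∨
      (c + 3 = n ∧ Odd a ∧ Odd b ∧ Odd c ∧ Nat.gcd (a + b) (b + c) = 2) := by
  rw [index_eq_zero_iff]
  rcases hcn.lt_or_eq with hlt | rfl
  · rw [isFrobenius_seaweed_iff_of_lt hab hlt, isFrobeniusPair_sub_iff hab hlt]
  · exact iff_of_false (not_isFrobenius_seaweed_self hn hab) (by omega)

theorem mainTheorem2 (K : Type*) [Field K] [IsAlgClosed K] [CharZero K]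
    (n a b c : ℕ) (ha : 0 < a) (hb : 0 < b) (hc : 0 < c) (hab : a + b = n) (hcn : c ≤ n) :
    SymplecticSeaweed.index K (SymplecticSeaweed.seaweed K n [a, b] [c]) = 0 ↔
      (c + 1 = n ∧ Nat.gcd (a + b) (b + c) = 1) ∨
      (c + 2 = n ∧ Nat.gcd (a + b) (b + c) = 1) ∨
      (c + 3 = n ∧ Odd a ∧ Odd b ∧ Odd c ∧ Nat.gcd (a + b) (b + c) = 2) :=
  mainTheorem2_general K (by omega) hab hcn
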